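/- Let $D\subset\mathbb R^d$ be a measurable set, let $\varrho_D$ be an arbitrary measure on $D$ (not necessarily finite or $\sigma$-finite), and let $H(K)$ be a separable reproducing kernel Hilbert space of complex-valued functions on $D$ with reproducing kernel $K$, so that $f(x)=\langle f,K(\cdot,x)\rangle_{H(K)}$ for all $f\in H(K)$, $x\in D$. Assume that the functions in $H(K)$ are $\varrho_D$-measurable and that $$0<\operatorname{tr}(K):=\int_D K(x,x)\,d\varrho_D(x)<\infty .$$ Then every $f\in H(K)$ is square integrable; let $\|\mathrm{Id}\|$ denote the operator norm of the embedding $\mathrm{Id}:H(K)\to L_2(D,\varrho_D)$, $f\mapsto f$. Put $\nu(x):=K(x,x)/\operatorname{tr}(K)$, which is a probability density with respect to $\varrho_D$. Let $n\ge 1$ be an integer, let the nodes $x^1,\dots,x^n$ be drawn independently from the probability measure $\nu\,d\varrho_D$, that is, $(x^1,\dots,x^n)$ is drawn from the product measure $(\nu\,d\varrho_D)^n$ on $D^n$, and denote by $$E(x^1,\dots,x^n):=\sup_{\|f\|_{H(K)}\le 1}\left|\int_D|f(x)|^2\,d\varrho_D(x)-\frac1n\sum_{i=1}^n\frac{|f(x^i)|^2}{\nu(x^i)}\right|$$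 the weighted discretization error, where the quotient is read as $0$ if $\nu(x^i)=0$ (an event of probability zero). Then: 1. For all $0<t\le 1$, $$\mathbb P\big(E>t\,\|\mathrm{Id}\|^2\big)\le 2^{3/4}\,n\,\exp\!\left(-\frac{n\,t^2\,\|\mathrm{Id}\|^2}{21\operatorname{tr}(K)}\right).$$ 2. For all $r>1$, if $21\,r\operatorname{tr}(K)\log n\le n\,\|\mathrm{Id}\|^2$ (for $n\ge 2$ this says $\frac{n}{\log n}\ge\frac{21\,r\operatorname{tr}(K)}{\|\mathrm{Id}\|^2}$), then $$\mathbb P\left(E\le\sqrt{21\operatorname{tr}(K)\,\|\mathrm{Id}\|^2\,r\,\frac{\log n}{n}}\right)>1-2n^{1-r}.$$ -/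

import Mathlib

open MeasureTheory
open scoped InnerProductSpace ENNReal

noncomputable section

/-! `RKHS ℂ H X ℂ` is Mathlib's class of reproducing kernel Hilbert spaces of complex valued
functions on `X`: a Hilbert space `H` with a linear injection into the functions `X → ℂ` such that
all point evaluations are continuous. -/

section RKHSDefs

variable {X : Type*} (H : Type*) [NormedAddCommGroup H] [InnerProductSpace ℂ H]
  [CompleteSpace H] [RKHS ℂ H X ℂ]

/-- The complex valued reproducing kernel `K(x, y)` of `H`, where `K(·, y) ∈ H` and
`f(y) = ⟨f, K(·, y)⟩` for `f ∈ H`. (Mathlib's `RKHS.kernel H x y` is the map `z ↦ K(x, y) z`.) -/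
def kernelFun (x y : X) : ℂ := RKHS.kernel H x y 1

/-- `K(x, x)` is real, and it is the squared norm of `K(·, x)`. -/
theorem kernelFun_self (x : X) : kernelFun H x x = ((‖RKHS.kerFun H x 1‖ ^ 2 : ℝ) : ℂ) := by
  have h := RKHS.kerFun_inner (H := H) x (1 : ℂ) (RKHS.kerFun H x 1)
  rw [RKHS.kerFun_apply, inner_self_eq_norm_sq_to_K] at h
  simp only [kernelFun]
  rw [RCLike.inner_apply] at h
  simp only [map_one, mul_one] at h
  rw [← h]
  simp

theorem kernelFun_self_re (x : X) : (kernelFun H x x).re = ‖RKHS.kerFun H x 1‖ ^ 2 := by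
  rw [kernelFun_self, Complex.ofReal_re]

variable {H} in
theorem norm_sq_apply_le (f : H) (x : X) : ‖f x‖ ^ 2 ≤ ‖f‖ ^ 2 * (kernelFun H x x).re := by
  have h := RKHS.kerFun_inner (H := H) x (1 : ℂ) f
  have h1 : f x = ⟪RKHS.kerFun H x 1, f⟫_ℂ := by rw [h]; simp [RCLike.inner_apply]
  rw [kernelFun_self_re, h1, ← mul_pow, mul_comm]
  exact pow_le_pow_left₀ (norm_nonneg _) (norm_inner_le_norm _ _) 2

variable [MeasurableSpace X] (ϱ : Measure X)

/-- The finite trace condition `∫ K(x, x) dϱ(x) < ∞`. -/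
def FiniteTrace : Prop := Integrable (fun x => (kernelFun H x x).re) ϱ

/-- The trace `tr(K) = ∫ K(x, x) dϱ(x)`. -/
def kernelTrace : ℝ := ∫ x, (kernelFun H x x).re ∂ϱ

variable {H ϱ} in
theorem memLp_two_of_finiteTrace (hmeas : ∀ f : H, AEStronglyMeasurable (fun x => f x) ϱ)
    (htr : FiniteTrace H ϱ) (f : H) : MemLp (fun x => f x) 2 ϱ := by
  refine (memLp_two_iff_integrable_sq_norm (hmeas f)).2 ?_
  refine (Integrable.const_mul htr (‖f‖ ^ 2)).mono' ((hmeas f).norm.pow 2) ?_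
  refine Filter.Eventually.of_forall fun x => ?_
  rw [Real.norm_of_nonneg (by positivity)]
  exact norm_sq_apply_le f x

theorem kernelTrace_nonneg : 0 ≤ kernelTrace H ϱ :=
  integral_nonneg fun x => by rw [Pi.zero_apply, kernelFun_self_re]; positivity

variable {H ϱ} in
theorem integral_norm_sq_apply_le (htr : FiniteTrace H ϱ) (f : H) :
    ∫ x, ‖f x‖ ^ 2 ∂ϱ ≤ ‖f‖ ^ 2 * kernelTrace H ϱ := by
  rw [kernelTrace, ← integral_const_mul]
  exact integral_mono_of_nonneg (Filter.Eventually.of_forall fun x => by positivity)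
    (Integrable.const_mul htr _) (Filter.Eventually.of_forall fun x => norm_sq_apply_le f x)

variable {ϱ} in
theorem norm_sq_toLp {g : X → ℂ} (hg : MemLp g 2 ϱ) :
    ‖hg.toLp g‖ ^ 2 = ∫ x, ‖g x‖ ^ 2 ∂ϱ := by
  have h0 : 0 ≤ ∫ x, ‖g x‖ ^ 2 ∂ϱ := integral_nonneg fun x => by positivity
  rw [Lp.norm_toLp, hg.eLpNorm_eq_integral_rpow_norm (by norm_num) (by norm_num),
    ENNReal.toReal_ofReal (Real.rpow_nonneg (integral_nonneg fun x => by positivity) _)]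
  simp only [ENNReal.toReal_ofNat, Real.rpow_two]
  rw [← Real.rpow_natCast, ← Real.rpow_mul h0]
  norm_num

variable {H ϱ} in
/-- The embedding `Id : H(K) → L₂(X, ϱ)`, `f ↦ f`, as a bounded linear operator. -/
def embL2 (hmeas : ∀ f : H, AEStronglyMeasurable (fun x => f x) ϱ) (htr : FiniteTrace H ϱ) :
    H →L[ℂ] Lp ℂ 2 ϱ :=
  LinearMap.mkContinuous
    { toFun := fun f => (memLp_two_of_finiteTrace hmeas htr f).toLp (fun x => f x)
      map_add' := fun f g => by
        rw [← MemLp.toLp_add]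
        exact MemLp.toLp_congr _ _ (Filter.Eventually.of_forall fun x => by simp)
      map_smul' := fun c f => by
        rw [RingHom.id_apply, ← MemLp.toLp_const_smul]
        exact MemLp.toLp_congr _ _ (Filter.Eventually.of_forall fun x => by simp) }
    (Real.sqrt (kernelTrace H ϱ)) (fun f => by
      rw [LinearMap.coe_mk, AddHom.coe_mk, mul_comm]
      refine (sq_le_sq₀ (norm_nonneg _) (by positivity)).1 ?_
      rw [norm_sq_toLp, mul_pow, Real.sq_sqrt (kernelTrace_nonneg H ϱ)]
      exact integral_norm_sq_apply_le htr f)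

/-- The density `ν(x) = K(x, x) / tr(K)` with respect to `ϱ`. -/
def samplingDensity (x : X) : ℝ := (kernelFun H x x).re / kernelTrace H ϱ

/-- The measure `ν dϱ` from which each node is drawn. -/
def samplingMeasure : Measure X := ϱ.withDensity fun x => ENNReal.ofReal (samplingDensity H ϱ x)

/-- `ν dϱ` is a probability measure. -/
theorem isProbabilityMeasure_samplingMeasure (htr : FiniteTrace H ϱ)
    (hpos : 0 < kernelTrace H ϱ) : IsProbabilityMeasure (samplingMeasure H ϱ) := by
  refine ⟨?_⟩
  rw [samplingMeasure, withDensity_apply _ MeasurableSet.univ, Measure.restrict_univ,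
    show (fun x => ENNReal.ofReal (samplingDensity H ϱ x)) =
      fun x => ENNReal.ofReal ((kernelFun H x x).re / kernelTrace H ϱ) from rfl,
    ← ofReal_integral_eq_lintegral_ofReal (Integrable.div_const htr _)
    (Filter.Eventually.of_forall fun x => div_nonneg
      (by rw [kernelFun_self_re]; positivity) hpos.le)]
  rw [integral_div, ← kernelTrace, div_self hpos.ne', ENNReal.ofReal_one]

/-- The worst case error
`sup_{‖f‖ ≤ 1} |∫ |f|² dϱ - (1/n) ∑ᵢ |f(xⁱ)|² / ν(xⁱ)|` of the weighted discretization of the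
squared `L₂`-norm at the nodes `xs = (x¹, …, xⁿ)`. -/
def weightedDiscrError {n : ℕ} (xs : Fin n → X) : ℝ :=
  ⨆ f : {f : H // ‖f‖ ≤ 1},
    |(∫ x, ‖f.1 x‖ ^ 2 ∂ϱ) - (1 / (n : ℝ)) * ∑ i, ‖f.1 (xs i)‖ ^ 2 / samplingDensity H ϱ (xs i)|

/-- The supremum in `weightedDiscrError` is over a set of reals that is bounded above. -/
theorem bddAbove_weightedDiscrError (htr : FiniteTrace H ϱ) {n : ℕ} (xs : Fin n → X) :
    BddAbove (Set.range fun f : {f : H // ‖f‖ ≤ 1} =>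
      |(∫ x, ‖f.1 x‖ ^ 2 ∂ϱ) -
        (1 / (n : ℝ)) * ∑ i, ‖f.1 (xs i)‖ ^ 2 / samplingDensity H ϱ (xs i)|) := by
  have ht := kernelTrace_nonneg H ϱ
  refine ⟨kernelTrace H ϱ + (1 / (n : ℝ)) * ∑ _i : Fin n, kernelTrace H ϱ, ?_⟩
  rintro _ ⟨⟨f, hf⟩, rfl⟩
  have hf2 : ‖f‖ ^ 2 ≤ 1 := pow_le_one₀ (norm_nonneg _) hf
  have h1 : ∫ x, ‖f x‖ ^ 2 ∂ϱ ≤ kernelTrace H ϱ :=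
    (integral_norm_sq_apply_le htr f).trans (mul_le_of_le_one_left ht hf2)
  have h0 : 0 ≤ ∫ x, ‖f x‖ ^ 2 ∂ϱ := integral_nonneg fun x => by positivity
  have hK (x : X) : 0 ≤ (kernelFun H x x).re := by rw [kernelFun_self_re]; positivity
  have h2 (i : Fin n) : ‖f (xs i)‖ ^ 2 / samplingDensity H ϱ (xs i) ≤ kernelTrace H ϱ := by
    rcases ht.eq_or_lt with h | h
    · rw [samplingDensity, ← h, div_zero, div_zero]
    · refine div_le_of_le_mul₀ (div_nonneg (hK _) ht) ht ?_
      rw [samplingDensity, mul_div_cancel₀ _ h.ne']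
      exact (norm_sq_apply_le f _).trans (mul_le_of_le_one_left (hK _) hf2)
  have h3 (i : Fin n) : 0 ≤ ‖f (xs i)‖ ^ 2 / samplingDensity H ϱ (xs i) :=
    div_nonneg (by positivity) (div_nonneg (hK _) ht)
  have h4 : (1 / (n : ℝ)) * ∑ i, ‖f (xs i)‖ ^ 2 / samplingDensity H ϱ (xs i) ≤
      (1 / (n : ℝ)) * ∑ _i : Fin n, kernelTrace H ϱ :=
    mul_le_mul_of_nonneg_left (Finset.sum_le_sum fun i _ => h2 i) (by positivity)
  have h5 : 0 ≤ (1 / (n : ℝ)) * ∑ i, ‖f (xs i)‖ ^ 2 / samplingDensity H ϱ (xs i) :=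
    mul_nonneg (by positivity) (Finset.sum_nonneg fun i _ => h3 i)
  exact abs_le.2 ⟨by linarith, by linarith⟩

end RKHSDefs

end

/-! Put u_x = K(·,x)/√ν(x), M = tr(K) and L = ‖Id‖² ≤ M. Then |f(x)|²/ν(x) = |⟨u_x, f⟩|² and ‖u_x‖²
≤ M, and under ν dϱ the rank-one operators u_x ⊗ u_x have mean Id* Id, of norm L. Hence n·E ≤ ‖Z‖
for Z = ∑ u_{xⁱ} ⊗ u_{xⁱ} − n Id* Id, and what is needed is concentration of sums of bounded
rank-one operators, with no dependence on dim H.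

The n vectors span at most n dimensions, so a noncommutative Khintchine inequality on that span
costs only a factor n. It is proved by flipping one sign at a time. Since A_i = u_i ⊗ u_i satisfies
A_i² ≤ M A_i, the variance is at most M‖∑ A_i‖, and summing even moments gives a Gaussian bound for
Rademacher sums (`sum_signs_cosh_norm_rankOne_le`).

Symmetrization (`integral_exp_norm_sum_sub_le`) carries this over to Z, but with a random variance.
As ‖∑ A_i‖ ≤ ‖Z‖ + nL, an exponential moment of ‖Z‖ reappears on the right; for s = t/(8M) its
exponent is at most s/4. Jensen bounds it by a fourth root of the left side, so the estimate closes
on itself (`integral_exp_norm_sum_rankOne_pow_three_le`). Markov's inequality gives the first claim;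
the second is the first for one value of t. -/

section SpectralSum

/-! ### Trace inequalities through eigenbases -/

variable {E : Type*} [NormedAddCommGroup E] [InnerProductSpace ℂ E] [FiniteDimensional ℂ E]

/-- The sum `∑ⱼ λⱼᵏ q(uⱼ)` over an orthonormal basis `uⱼ` of eigenvectors of `X` with eigenvalues
`λⱼ`. For a quadratic form `q(u) = ⟨u, B u⟩` this is the trace of `B Xᵏ`. -/
noncomputable def spectralSum {X : E →ₗ[ℂ] E} (hX : X.IsSymmetric) (q : E → ℝ) (k : ℕ) : ℝ :=
  ∑ j, hX.eigenvalues rfl j ^ k * q (hX.eigenvectorBasis rfl j)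

/-- In a pair of eigenbases W − Y has matrix entries (λ_j − μ_k)⟨v_k, u_j⟩, so trace inequalities
for the noncommuting W and Y reduce to scalar ones. -/
theorem inner_sub_eigenvectorBasis {W Y : E →ₗ[ℂ] E} (hW : W.IsSymmetric) (hY : Y.IsSymmetric)
    (j k : Fin (Module.finrank ℂ E)) :
    ⟪hY.eigenvectorBasis rfl k, (W - Y) (hW.eigenvectorBasis rfl j)⟫_ℂ =
      ((hW.eigenvalues rfl j - hY.eigenvalues rfl k : ℝ) : ℂ) *
        ⟪hY.eigenvectorBasis rfl k, hW.eigenvectorBasis rfl j⟫_ℂ := by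
  rw [LinearMap.sub_apply, inner_sub_right, ← hY, hW.apply_eigenvectorBasis,
    hY.apply_eigenvectorBasis, inner_smul_right, inner_smul_left]
  simp [sub_mul]

theorem re_inner_sub_eigenvectorBasis {W Y : E →ₗ[ℂ] E} (hW : W.IsSymmetric) (hY : Y.IsSymmetric)
    (j : Fin (Module.finrank ℂ E)) :
    (⟪hW.eigenvectorBasis rfl j, (W - Y) (hW.eigenvectorBasis rfl j)⟫_ℂ).re =
      ∑ k, (hW.eigenvalues rfl j - hY.eigenvalues rfl k) *
        ‖⟪hY.eigenvectorBasis rfl k, hW.eigenvectorBasis rfl j⟫_ℂ‖ ^ 2 := by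
  rw [← (hY.eigenvectorBasis rfl).sum_inner_mul_inner, Complex.re_sum]
  refine Finset.sum_congr rfl fun k _ => ?_
  rw [inner_sub_eigenvectorBasis, mul_left_comm, ← inner_conj_symm, RCLike.conj_mul,
    Complex.re_ofReal_mul]
  norm_cast

theorem norm_sq_sub_eigenvectorBasis {W Y : E →ₗ[ℂ] E} (hW : W.IsSymmetric) (hY : Y.IsSymmetric)
    (j : Fin (Module.finrank ℂ E)) :
    ‖(W - Y) (hW.eigenvectorBasis rfl j)‖ ^ 2 =
      ∑ k, (hW.eigenvalues rfl j - hY.eigenvalues rfl k) ^ 2 *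
        ‖⟪hY.eigenvectorBasis rfl k, hW.eigenvectorBasis rfl j⟫_ℂ‖ ^ 2 := by
  rw [← (hY.eigenvectorBasis rfl).sum_sq_norm_inner_right]
  refine Finset.sum_congr rfl fun k _ => ?_
  rw [inner_sub_eigenvectorBasis, norm_mul, mul_pow, Complex.norm_real, Real.norm_eq_abs, sq_abs]

/-- Terms i and 2p − i are paired: |a|^i − |b|^i and |a|^(2p−i) − |b|^(2p−i) have the same sign, so
their product is nonnegative. -/
theorem two_mul_geom_sum_even_le (a b : ℝ) (p : ℕ) :
    2 * ∑ i ∈ Finset.range (2 * p + 1), a ^ i * b ^ (2 * p - i) ≤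
      (2 * p + 1) * (a ^ (2 * p) + b ^ (2 * p)) := by
  have hpair : ∀ i ∈ Finset.range (2 * p + 1),
      a ^ i * b ^ (2 * p - i) + a ^ (2 * p - i) * b ^ i ≤ a ^ (2 * p) + b ^ (2 * p) := by
    intro i hi
    obtain ⟨l, hl⟩ := Nat.exists_eq_add_of_le (Nat.lt_succ_iff.1 (Finset.mem_range.1 hi))
    have hl' : 2 * p - i = l := by omega
    have hev : Even (2 * p) := even_two_mul p
    rw [hl', ← hev.pow_abs a, ← hev.pow_abs b, hl, pow_add, pow_add]
    have h1 : a ^ i * b ^ l ≤ |a| ^ i * |b| ^ l := by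
      rw [← abs_pow, ← abs_pow, ← abs_mul]; exact le_abs_self _
    have h2 : a ^ l * b ^ i ≤ |a| ^ l * |b| ^ i := by
      rw [← abs_pow, ← abs_pow, ← abs_mul]; exact le_abs_self _
    have h3 : 0 ≤ (|a| ^ i - |b| ^ i) * (|a| ^ l - |b| ^ l) := by
      rcases le_total |a| |b| with h | h
      · exact mul_nonneg_of_nonpos_of_nonpos
          (sub_nonpos.2 (pow_le_pow_left₀ (abs_nonneg _) h _))
          (sub_nonpos.2 (pow_le_pow_left₀ (abs_nonneg _) h _))
      · exact mul_nonneg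
          (sub_nonneg.2 (pow_le_pow_left₀ (abs_nonneg _) h _))
          (sub_nonneg.2 (pow_le_pow_left₀ (abs_nonneg _) h _))
    nlinarith
  have hrefl : ∑ i ∈ Finset.range (2 * p + 1), a ^ i * b ^ (2 * p - i) =
      ∑ i ∈ Finset.range (2 * p + 1), a ^ (2 * p - i) * b ^ i := by
    rw [← Finset.sum_range_reflect]
    refine Finset.sum_congr rfl fun i hi => ?_
    have := Finset.mem_range.1 hi
    congr 2
    omega
  calc _ = ∑ i ∈ Finset.range (2 * p + 1),
        (a ^ i * b ^ (2 * p - i) + a ^ (2 * p - i) * b ^ i) := by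
        rw [Finset.sum_add_distrib, ← hrefl, two_mul]
    _ ≤ ∑ i ∈ Finset.range (2 * p + 1), (a ^ (2 * p) + b ^ (2 * p)) := Finset.sum_le_sum hpair
    _ = _ := by
        rw [Finset.sum_const, Finset.card_range, nsmul_eq_mul]
        push_cast
        rfl

/-- The difference quotient of x^(2p+1) is at most the average of its derivative at the two
endpoints. -/
theorem sub_mul_pow_sub_pow_le (a b : ℝ) (p : ℕ) :
    (a - b) * (a ^ (2 * p + 1) - b ^ (2 * p + 1)) ≤
      (2 * p + 1) / 2 * ((a - b) ^ 2 * (a ^ (2 * p) + b ^ (2 * p))) := by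
  rw [← geom_sum₂_mul]
  have h := mul_le_mul_of_nonneg_left (two_mul_geom_sum_even_le a b p) (sq_nonneg (a - b))
  simp only [Nat.add_sub_cancel] at h ⊢
  nlinarith

/-- The mean value trace inequality for odd powers. -/
theorem spectralSum_sub_le {W Y : E →ₗ[ℂ] E} (hW : W.IsSymmetric) (hY : Y.IsSymmetric) (p : ℕ) :
    spectralSum hW (fun u => (⟪u, (W - Y) u⟫_ℂ).re) (2 * p + 1) -
        spectralSum hY (fun u => (⟪u, (W - Y) u⟫_ℂ).re) (2 * p + 1) ≤
      (2 * p + 1) / 2 * (spectralSum hW (fun u => ‖(W - Y) u‖ ^ 2) (2 * p) +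
        spectralSum hY (fun u => ‖(W - Y) u‖ ^ 2) (2 * p)) := by
  have hneg : ∀ u, (⟪u, (W - Y) u⟫_ℂ).re = -(⟪u, (Y - W) u⟫_ℂ).re := fun u => by
    rw [← neg_sub Y W, LinearMap.neg_apply, inner_neg_right, Complex.neg_re]
  have hnorm : ∀ u, ‖(W - Y) u‖ ^ 2 = ‖(Y - W) u‖ ^ 2 := fun u => by
    rw [← neg_sub Y W, LinearMap.neg_apply, norm_neg]
  have h1 : spectralSum hY (fun u => (⟪u, (W - Y) u⟫_ℂ).re) (2 * p + 1) =
      ∑ j, ∑ k, hY.eigenvalues rfl k ^ (2 * p + 1) *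
        ((hW.eigenvalues rfl j - hY.eigenvalues rfl k) *
          ‖⟪hY.eigenvectorBasis rfl k, hW.eigenvectorBasis rfl j⟫_ℂ‖ ^ 2) := by
    rw [Finset.sum_comm]
    refine Finset.sum_congr rfl fun k _ => ?_
    simp only [hneg]
    rw [re_inner_sub_eigenvectorBasis hY hW, ← Finset.sum_neg_distrib, Finset.mul_sum]
    refine Finset.sum_congr rfl fun j _ => ?_
    rw [norm_inner_symm]
    ring
  have h2 : spectralSum hY (fun u => ‖(W - Y) u‖ ^ 2) (2 * p) =
      ∑ j, ∑ k, hY.eigenvalues rfl k ^ (2 * p) *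
        ((hW.eigenvalues rfl j - hY.eigenvalues rfl k) ^ 2 *
          ‖⟪hY.eigenvectorBasis rfl k, hW.eigenvectorBasis rfl j⟫_ℂ‖ ^ 2) := by
    rw [Finset.sum_comm]
    refine Finset.sum_congr rfl fun k _ => ?_
    simp only [hnorm]
    rw [norm_sq_sub_eigenvectorBasis hY hW, Finset.mul_sum]
    refine Finset.sum_congr rfl fun j _ => ?_
    rw [norm_inner_symm]
    ring
  -- Expanded in both eigenbases, all four traces are double sums with the same weights |⟨v_k,
  -- u_j⟩|², so the scalar inequality applies to each pair (λ_j, μ_k).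
  rw [h1, h2]
  simp only [spectralSum, re_inner_sub_eigenvectorBasis hW hY, norm_sq_sub_eigenvectorBasis hW hY,
    Finset.mul_sum]
  simp only [← Finset.sum_add_distrib, ← Finset.sum_sub_distrib, Finset.mul_sum]
  refine Finset.sum_le_sum fun j _ => Finset.sum_le_sum fun k _ => ?_
  have h := mul_le_mul_of_nonneg_right
    (sub_mul_pow_sub_pow_le (hW.eigenvalues rfl j) (hY.eigenvalues rfl k) p)
    (sq_nonneg ‖⟪hY.eigenvectorBasis rfl k, hW.eigenvectorBasis rfl j⟫_ℂ‖)
  linarith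

end SpectralSum

/-! ### Noncommutative Khintchine inequality -/

section SignedSums

variable {E : Type*} [NormedAddCommGroup E] [InnerProductSpace ℂ E]
  {ι : Type*} [Fintype ι]

theorem isSymmetric_sum_units_smul {A : ι → E →ₗ[ℂ] E} (hA : ∀ i, (A i).IsSymmetric)
    (ε : ι → ℤˣ) : (∑ i, ε i • A i).IsSymmetric := by
  intro x y
  simp only [LinearMap.sum_apply, sum_inner, inner_sum]
  refine Finset.sum_congr rfl fun i _ => ?_
  rcases Int.units_eq_one_or (ε i) with h | h <;> simp [h, hA i x y]

variable [FiniteDimensional ℂ E]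

theorem spectralSum_self {X : E →ₗ[ℂ] E} (hX : X.IsSymmetric) (k : ℕ) :
    spectralSum hX (fun u => (⟪u, X u⟫_ℂ).re) k = spectralSum hX (fun _ => 1) (k + 1) := by
  refine Finset.sum_congr rfl fun j _ => ?_
  simp only [hX.apply_eigenvectorBasis]
  rw [inner_smul_right, inner_self_eq_norm_sq_to_K,
    (hX.eigenvectorBasis rfl).norm_eq_one]
  simp [pow_succ]

variable [DecidableEq ι]

/-- A discrete integration by parts. Flipping the sign ε_i changes the signed sum X by 2 ε_i A_i, so
the mean value trace inequality for X and its flip controls the trace of ε_i A_i X^(2p+1). -/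
theorem sum_signs_spectralSum_single_le {A : ι → E →ₗ[ℂ] E} (hA : ∀ i, (A i).IsSymmetric) (p : ℕ)
    (i : ι) :
    ∑ ε : ι → ℤˣ, spectralSum (isSymmetric_sum_units_smul hA ε)
        (fun u => (⟪u, (ε i • A i) u⟫_ℂ).re) (2 * p + 1) ≤
      (2 * p + 1) * ∑ ε : ι → ℤˣ, spectralSum (isSymmetric_sum_units_smul hA ε)
        (fun u => ‖A i u‖ ^ 2) (2 * p) := by
  let flip : (ι → ℤˣ) ≃ (ι → ℤˣ) := Equiv.mulRight (Pi.mulSingle i (-1))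
  have hdiff (ε : ι → ℤˣ) :
      (∑ l, ε l • A l) - ∑ l, flip ε l • A l = (2 : ℂ) • (ε i • A i) := by
    rw [← Finset.sum_sub_distrib, Finset.sum_eq_single i]
    · simp [flip, two_smul]
    · intro l _ hl
      simp [flip, Pi.mulSingle_eq_of_ne hl]
    · simp
  have hkey (ε : ι → ℤˣ) :
      spectralSum (isSymmetric_sum_units_smul hA ε)
          (fun u => (⟪u, (ε i • A i) u⟫_ℂ).re) (2 * p + 1) +
        spectralSum (isSymmetric_sum_units_smul hA (flip ε))
          (fun u => (⟪u, (flip ε i • A i) u⟫_ℂ).re) (2 * p + 1) ≤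
      (2 * p + 1) * (spectralSum (isSymmetric_sum_units_smul hA ε)
          (fun u => ‖A i u‖ ^ 2) (2 * p) +
        spectralSum (isSymmetric_sum_units_smul hA (flip ε)) (fun u => ‖A i u‖ ^ 2) (2 * p)) := by
    have h := spectralSum_sub_le (isSymmetric_sum_units_smul hA ε)
      (isSymmetric_sum_units_smul hA (flip ε)) p
    rw [hdiff] at h
    have e1 : ∀ u, (⟪u, ((2 : ℂ) • (ε i • A i)) u⟫_ℂ).re = 2 * (⟪u, (ε i • A i) u⟫_ℂ).re := by
      intro u
      rw [LinearMap.smul_apply, inner_smul_right]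
      simp
    have e2 : ∀ u, ‖((2 : ℂ) • (ε i • A i)) u‖ ^ 2 = 4 * ‖A i u‖ ^ 2 := by
      intro u
      rw [LinearMap.smul_apply, norm_smul]
      rcases Int.units_eq_one_or (ε i) with h | h <;> simp [h] <;> ring
    have e3 : ∀ u, (⟪u, (flip ε i • A i) u⟫_ℂ).re = -(⟪u, (ε i • A i) u⟫_ℂ).re := by
      intro u
      simp [flip]
    simp only [e1, e2, e3, spectralSum, mul_neg, Finset.sum_neg_distrib, mul_left_comm _ (2 : ℝ),
      mul_left_comm _ (4 : ℝ), ← Finset.mul_sum] at h ⊢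
    linarith
  -- The flip permutes the sign patterns, so each pattern and its flip contribute the same total and
  -- a factor 2 cancels.
  have hs1 := Equiv.sum_comp flip fun ε : ι → ℤˣ => spectralSum (isSymmetric_sum_units_smul hA ε)
        (fun u => (⟪u, (ε i • A i) u⟫_ℂ).re) (2 * p + 1)
  have hs2 := Equiv.sum_comp flip fun ε : ι → ℤˣ => spectralSum (isSymmetric_sum_units_smul hA ε)
        (fun u => ‖A i u‖ ^ 2) (2 * p)
  have hsum := Finset.sum_le_sum fun ε (_ : ε ∈ Finset.univ) => hkey ε
  rw [Finset.sum_add_distrib, ← Finset.mul_sum, Finset.sum_add_distrib, hs1, hs2]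
    at hsum
  linarith

/-- Write X^(2p+2) as ∑ ε_i A_i X^(2p+1), treat each i separately, and recombine with ∑ A_i² ≤ V,
using that X^(2p) is positive. -/
theorem sum_signs_spectralSum_succ_le {A : ι → E →ₗ[ℂ] E} (hA : ∀ i, (A i).IsSymmetric)
    {V : ℝ} (hV : ∀ u, ∑ i, ‖A i u‖ ^ 2 ≤ V * ‖u‖ ^ 2) (p : ℕ) :
    ∑ ε : ι → ℤˣ, spectralSum (isSymmetric_sum_units_smul hA ε) (fun _ => 1) (2 * (p + 1)) ≤
      (2 * p + 1) * V *
        ∑ ε : ι → ℤˣ, spectralSum (isSymmetric_sum_units_smul hA ε) (fun _ => 1) (2 * p) := by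
  calc _ = ∑ ε : ι → ℤˣ, ∑ i, spectralSum (isSymmetric_sum_units_smul hA ε)
        (fun u => (⟪u, (ε i • A i) u⟫_ℂ).re) (2 * p + 1) := by
        refine Finset.sum_congr rfl fun ε _ => ?_
        rw [show 2 * (p + 1) = 2 * p + 1 + 1 by ring, ← spectralSum_self]
        simp only [spectralSum]
        rw [Finset.sum_comm]
        refine Finset.sum_congr rfl fun j _ => ?_
        rw [← Finset.mul_sum, LinearMap.sum_apply, inner_sum, Complex.re_sum]
    _ ≤ ∑ i, (2 * p + 1) * ∑ ε : ι → ℤˣ, spectralSum (isSymmetric_sum_units_smul hA ε)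
        (fun u => ‖A i u‖ ^ 2) (2 * p) := by
        rw [Finset.sum_comm]
        exact Finset.sum_le_sum fun i _ => sum_signs_spectralSum_single_le hA p i
    _ = (2 * p + 1) * ∑ ε : ι → ℤˣ, spectralSum (isSymmetric_sum_units_smul hA ε)
        (fun u => ∑ i, ‖A i u‖ ^ 2) (2 * p) := by
        rw [← Finset.mul_sum, Finset.sum_comm]
        congr 1
        refine Finset.sum_congr rfl fun ε _ => ?_
        simp only [spectralSum]
        rw [Finset.sum_comm]
        simp only [← Finset.mul_sum]
    _ ≤ _ := by
        rw [mul_assoc, Finset.mul_sum _ _ V]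
        refine mul_le_mul_of_nonneg_left (Finset.sum_le_sum fun ε _ => ?_) (by positivity)
        rw [spectralSum, spectralSum, Finset.mul_sum]
        refine Finset.sum_le_sum fun j _ => ?_
        rw [mul_left_comm]
        refine mul_le_mul_of_nonneg_left ?_
          ((even_two_mul p).pow_nonneg ((isSymmetric_sum_units_smul hA ε).eigenvalues rfl j))
        simpa using hV ((isSymmetric_sum_units_smul hA ε).eigenvectorBasis rfl j)

/-- The noncommutative Khintchine inequality for even moments, with its sharp constants. -/
theorem sum_signs_spectralSum_le {A : ι → E →ₗ[ℂ] E} (hA : ∀ i, (A i).IsSymmetric)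
    {V : ℝ} (hV0 : 0 ≤ V) (hV : ∀ u, ∑ i, ‖A i u‖ ^ 2 ≤ V * ‖u‖ ^ 2) (p : ℕ) :
    ∑ ε : ι → ℤˣ, spectralSum (isSymmetric_sum_units_smul hA ε) (fun _ => 1) (2 * p) ≤
      Fintype.card (ι → ℤˣ) * Module.finrank ℂ E *
        ((2 * p).factorial / (2 ^ p * p.factorial) * V ^ p) := by
  -- The factors 2p + 1 multiply up to (2p − 1)!! = (2p)!/(2^p p!); at p = 0 the trace is the
  -- dimension.
  induction p with
  | zero => simp [spectralSum]
  | succ p ih =>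
    refine (sum_signs_spectralSum_succ_le hA hV p).trans ?_
    have hc : 0 ≤ (2 * (p : ℝ) + 1) * V := by positivity
    refine (mul_le_mul_of_nonneg_left ih hc).trans_eq ?_
    rw [show 2 * (p + 1) = 2 * p + 1 + 1 by ring, Nat.factorial_succ, Nat.factorial_succ,
      Nat.factorial_succ p]
    push_cast
    field_simp
    ring

/-- Each λ_j^(2p) is one term of a nonnegative sum, hence |λ_j| ≤ c. -/
theorem norm_apply_le_of_spectralSum_le {X : E →ₗ[ℂ] E} (hX : X.IsSymmetric) {p : ℕ} (hp : p ≠ 0)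
    {c : ℝ} (hc : 0 ≤ c) (h : spectralSum hX (fun _ => 1) (2 * p) ≤ c ^ (2 * p)) (u : E) :
    ‖X u‖ ≤ c * ‖u‖ := by
  have hle (j) : hX.eigenvalues rfl j ^ 2 ≤ c ^ 2 := by
    rw [sq_le_sq, abs_of_nonneg hc]
    refine le_of_pow_le_pow_left₀ (n := 2 * p) (by omega) hc ?_
    rw [(even_two_mul p).pow_abs]
    refine le_trans ?_ h
    simp only [spectralSum, mul_one]
    exact Finset.single_le_sum (f := fun j => hX.eigenvalues rfl j ^ (2 * p))
      (fun j _ => (even_two_mul p).pow_nonneg (hX.eigenvalues rfl j)) (Finset.mem_univ j)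
  refine (sq_le_sq₀ (norm_nonneg _) (by positivity)).1 ?_
  rw [mul_pow, ← (hX.eigenvectorBasis rfl).sum_sq_norm_inner_right (X u),
    ← (hX.eigenvectorBasis rfl).sum_sq_norm_inner_right u, Finset.mul_sum]
  refine Finset.sum_le_sum fun j _ => ?_
  rw [← hX, hX.apply_eigenvectorBasis, inner_smul_left, norm_mul, mul_pow]
  refine mul_le_mul_of_nonneg_right ?_ (by positivity)
  simpa using hle j

end SignedSums

/-! ### Rademacher sums of rank-one operators -/

section RankOneSums

variable {H : Type*} [NormedAddCommGroup H] [InnerProductSpace ℂ H]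
  {ι : Type*} [Fintype ι]

theorem inner_sum_rankOne_self (v : ι → H) (u : H) :
    ⟪u, (∑ i, InnerProductSpace.rankOne ℂ (v i) (v i)) u⟫_ℂ =
      ((∑ i, ‖⟪v i, u⟫_ℂ‖ ^ 2 : ℝ) : ℂ) := by
  rw [sum_apply, inner_sum]
  push_cast
  refine Finset.sum_congr rfl fun i _ => ?_
  rw [InnerProductSpace.rankOne_apply, inner_smul_right, ← inner_conj_symm u, RCLike.mul_conj]
  rfl

theorem sum_norm_sq_inner_le (v : ι → H) (u : H) :
    ∑ i, ‖⟪v i, u⟫_ℂ‖ ^ 2 ≤ ‖∑ i, InnerProductSpace.rankOne ℂ (v i) (v i)‖ * ‖u‖ ^ 2 := by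
  have h0 : 0 ≤ ∑ i, ‖⟪v i, u⟫_ℂ‖ ^ 2 := Finset.sum_nonneg fun i _ => by positivity
  rw [← Real.norm_of_nonneg h0, ← Complex.norm_real, ← inner_sum_rankOne_self]
  refine (norm_inner_le_norm _ _).trans ?_
  have := mul_le_mul_of_nonneg_left
    ((∑ i, InnerProductSpace.rankOne ℂ (v i) (v i)).le_opNorm u) (norm_nonneg u)
  linarith

/-- The operator vanishes on Sᗮ and maps into S, so its norm is governed by its restriction to the
finite dimensional S. -/
theorem norm_sum_units_smul_rankOne_pow_le {S : Submodule ℂ H} [FiniteDimensional ℂ S]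
    (s : ι → S) (ε : ι → ℤˣ)
    (hsym : ∀ i, (InnerProductSpace.rankOne ℂ (s i) (s i) : S →ₗ[ℂ] S).IsSymmetric)
    {p : ℕ} (hp : p ≠ 0) :
    ‖∑ i, ε i • InnerProductSpace.rankOne ℂ (s i : H) (s i : H)‖ ^ (2 * p) ≤
      spectralSum (isSymmetric_sum_units_smul hsym ε) (fun _ => 1) (2 * p) := by
  set T := spectralSum (isSymmetric_sum_units_smul hsym ε) (fun _ => 1) (2 * p) with hT
  have hT0 : 0 ≤ T := Finset.sum_nonneg fun j _ => by
    rw [mul_one]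
    exact (even_two_mul p).pow_nonneg ((isSymmetric_sum_units_smul hsym ε).eigenvalues rfl j)
  have hp2 : 2 * p ≠ 0 := by omega
  set c : ℝ := T ^ (((2 * p : ℕ) : ℝ)⁻¹) with hc
  have hc0 : 0 ≤ c := Real.rpow_nonneg hT0 _
  have hcT : c ^ (2 * p) = T := Real.rpow_inv_natCast_pow hT0 hp2
  rw [← hcT]
  refine pow_le_pow_left₀ (norm_nonneg _) (ContinuousLinearMap.opNorm_le_bound _ hc0 fun w => ?_) _
  have hw : (∑ i, ε i • InnerProductSpace.rankOne ℂ (s i : H) (s i : H)) w =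
      (((∑ i, ε i • (InnerProductSpace.rankOne ℂ (s i) (s i) : S →ₗ[ℂ] S))
        (S.orthogonalProjectionOnto w) : S) : H) := by
    rw [sum_apply, LinearMap.sum_apply, Submodule.coe_sum]
    refine Finset.sum_congr rfl fun i _ => ?_
    rcases Int.units_eq_one_or (ε i) with h | h <;> simp [h]
  rw [hw]
  refine (norm_apply_le_of_spectralSum_le (isSymmetric_sum_units_smul hsym ε) hp hc0
    hcT.ge (S.orthogonalProjectionOnto w)).trans ?_
  exact mul_le_mul_of_nonneg_left (S.norm_orthogonalProjectionOnto_apply_le w) hc0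

/-- Rudelson's moment inequality for Rademacher sums of rank one operators. -/
theorem sum_signs_norm_rankOne_pow_le [DecidableEq ι] [Nonempty ι] {M : ℝ} (v : ι → H)
    (hv : ∀ i, ‖v i‖ ^ 2 ≤ M) (p : ℕ) :
    ∑ ε : ι → ℤˣ, ‖∑ i, ε i • InnerProductSpace.rankOne ℂ (v i) (v i)‖ ^ (2 * p) ≤
      Fintype.card (ι → ℤˣ) * Fintype.card ι * ((2 * p).factorial / (2 ^ p * p.factorial) *
        (M * ‖∑ i, InnerProductSpace.rankOne ℂ (v i) (v i)‖) ^ p) := by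
  have hM : 0 ≤ M := (sq_nonneg _).trans (hv (Classical.arbitrary ι))
  rcases eq_or_ne p 0 with rfl | hp
  -- At p = 0 the factor `Fintype.card ι` only has to be at least 1.
  · have h1 : (1 : ℝ) ≤ Fintype.card ι := by exact_mod_cast Fintype.card_pos
    have := mul_le_mul_of_nonneg_left h1 (Nat.cast_nonneg (α := ℝ) (Fintype.card (ι → ℤˣ)))
    simpa using this
  let S : Submodule ℂ H := Submodule.span ℂ (Set.range v)
  have : FiniteDimensional ℂ S := FiniteDimensional.span_of_finite ℂ (Set.finite_range v)
  let s : ι → S := fun i => ⟨v i, Submodule.subset_span (Set.mem_range_self i)⟩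
  have hsym (i) : (InnerProductSpace.rankOne ℂ (s i) (s i) : S →ₗ[ℂ] S).IsSymmetric := by
    intro x y
    simp [inner_smul_left, inner_smul_right, mul_comm]
  have hdim : (Module.finrank ℂ S : ℝ) ≤ Fintype.card ι := by
    exact_mod_cast finrank_range_le_card v
  -- A_i² = ‖v_i‖² A_i ≤ M A_i, so M‖∑ A_i‖ serves as the variance.
  have hV (u : S) : ∑ i, ‖(InnerProductSpace.rankOne ℂ (s i) (s i) : S →ₗ[ℂ] S) u‖ ^ 2 ≤
      (M * ‖∑ i, InnerProductSpace.rankOne ℂ (v i) (v i)‖) * ‖u‖ ^ 2 := by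
    rw [mul_assoc]
    refine le_trans ?_ (mul_le_mul_of_nonneg_left (sum_norm_sq_inner_le v (u : H)) hM)
    rw [Finset.mul_sum]
    refine Finset.sum_le_sum fun i _ => ?_
    have : ‖(InnerProductSpace.rankOne ℂ (s i) (s i) : S →ₗ[ℂ] S) u‖ =
        ‖⟪v i, (u : H)⟫_ℂ‖ * ‖v i‖ := by
      simp [norm_smul, s]
    rw [this, mul_pow, mul_comm]
    exact mul_le_mul_of_nonneg_right (hv i) (by positivity)
  have hV0 : 0 ≤ M * ‖∑ i, InnerProductSpace.rankOne ℂ (v i) (v i)‖ := by positivity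
  calc _ ≤ ∑ ε : ι → ℤˣ,
        spectralSum (isSymmetric_sum_units_smul hsym ε) (fun _ => 1) (2 * p) :=
        Finset.sum_le_sum fun ε _ => norm_sum_units_smul_rankOne_pow_le s ε hsym hp
    _ ≤ _ := sum_signs_spectralSum_le hsym hV0 hV p
    _ ≤ _ := by gcongr

/-- The series of cosh contains only even moments, and its 1/(2p)! turns (2p)!/(2^p p!) into the
coefficients of exp(θ²V/2). -/
theorem sum_signs_cosh_norm_rankOne_le [DecidableEq ι] [Nonempty ι] {M : ℝ} (v : ι → H)
    (hv : ∀ i, ‖v i‖ ^ 2 ≤ M) (θ : ℝ) :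
    ∑ ε : ι → ℤˣ, Real.cosh (θ * ‖∑ i, ε i • InnerProductSpace.rankOne ℂ (v i) (v i)‖) ≤
      Fintype.card (ι → ℤˣ) * Fintype.card ι *
        Real.exp (θ ^ 2 * (M * ‖∑ i, InnerProductSpace.rankOne ℂ (v i) (v i)‖) / 2) := by
  set V := M * ‖∑ i, InnerProductSpace.rankOne ℂ (v i) (v i)‖ with hV
  have h1 := hasSum_sum (s := Finset.univ) fun (ε : ι → ℤˣ) _ =>
    Real.hasSum_cosh (θ * ‖∑ i, ε i • InnerProductSpace.rankOne ℂ (v i) (v i)‖)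
  have h2 : HasSum (fun p : ℕ => (θ ^ 2 * V / 2) ^ p / p.factorial)
      (Real.exp (θ ^ 2 * V / 2)) := by
    rw [Real.exp_eq_exp_ℝ]
    exact NormedSpace.expSeries_div_hasSum_exp _
  refine hasSum_le (fun p => ?_) h1
    (h2.mul_left ((Fintype.card (ι → ℤˣ) : ℝ) * Fintype.card ι))
  have h3 := mul_le_mul_of_nonneg_left (sum_signs_norm_rankOne_pow_le v hv p)
    (show 0 ≤ θ ^ (2 * p) / ((2 * p).factorial : ℝ) from
      div_nonneg ((even_two_mul p).pow_nonneg θ) (by positivity))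
  rw [← hV] at h3
  calc _ = θ ^ (2 * p) / ((2 * p).factorial : ℝ) *
        ∑ ε : ι → ℤˣ, ‖∑ i, ε i • InnerProductSpace.rankOne ℂ (v i) (v i)‖ ^ (2 * p) := by
        rw [Finset.mul_sum]
        exact Finset.sum_congr rfl fun ε _ => by rw [mul_pow]; ring
    _ ≤ _ := h3
    _ = _ := by
        rw [div_pow, mul_pow (θ ^ 2), ← pow_mul]
        field_simp

end RankOneSums

/-! ### Symmetrization of exponential moments -/

section Symmetrization

theorem convexOn_exp_mul_norm_sub {B : Type*} [NormedAddCommGroup B] [NormedSpace ℝ B] {s : ℝ}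
    (hs : 0 ≤ s) (a : B) : ConvexOn ℝ Set.univ fun b => Real.exp (s * ‖a - b‖) := by
  have h : ConvexOn ℝ Set.univ fun b => s * ‖a - b‖ := by
    have := (convexOn_univ_dist a).smul hs
    simpa [dist_eq_norm_sub', smul_eq_mul] using this
  exact ⟨convex_univ, fun x hx y hy p q hp hq hpq =>
    (Real.exp_le_exp.2 (h.2 hx hy hp hq hpq)).trans
      (convexOn_exp.2 (Set.mem_univ _) (Set.mem_univ _) hp hq hpq)⟩

variable {B : Type*} [NormedAddCommGroup B] {Ω ι : Type*} [Fintype ι]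

theorem norm_units_smul (u : ℤˣ) (b : B) : ‖u • b‖ = ‖b‖ := by
  rcases Int.units_eq_one_or u with h | h <;> simp [h]

theorem norm_sum_units_smul_le {g : Ω → B} {C : ℝ} (hC : ∀ x, ‖g x‖ ≤ C) (ε : ι → ℤˣ)
    (x : ι → Ω) : ‖∑ i, ε i • g (x i)‖ ≤ Fintype.card ι * C := by
  refine (norm_sum_le _ _).trans ?_
  calc _ ≤ ∑ _i : ι, C := Finset.sum_le_sum fun i _ => by rw [norm_units_smul]; exact hC _
    _ = _ := by simp

variable [MeasurableSpace Ω]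

theorem integrable_exp_mul_norm_of_bounded {Ω' : Type*} [MeasurableSpace Ω'] {P : Measure Ω'}
    [IsFiniteMeasure P] {f : Ω' → B} (hf : StronglyMeasurable f) {C : ℝ} (hC : ∀ x, ‖f x‖ ≤ C)
    {s : ℝ} (hs : 0 ≤ s) : Integrable (fun x => Real.exp (s * ‖f x‖)) P := by
  refine Integrable.of_bound (C := Real.exp (s * C)) ?_ (Filter.Eventually.of_forall fun x => ?_)
  · exact (Real.continuous_exp.comp_stronglyMeasurable
      (hf.norm.const_mul s)).aestronglyMeasurable
  · rw [Real.norm_of_nonneg (Real.exp_pos _).le]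
    exact Real.exp_le_exp.2 (mul_le_mul_of_nonneg_left (hC x) hs)

variable {μ : Measure Ω} [IsProbabilityMeasure μ]

theorem stronglyMeasurable_sum_units_smul {g : Ω → B} (hg : StronglyMeasurable g) (ε : ι → ℤˣ) :
    StronglyMeasurable fun x : ι → Ω => ∑ i, ε i • g (x i) := by
  refine Finset.stronglyMeasurable_fun_sum _ fun i _ => ?_
  have h := hg.comp_measurable (measurable_pi_apply (X := fun _ : ι => Ω) i)
  rcases Int.units_eq_one_or (ε i) with h' | h'
  · simp only [h', one_smul]
    exact h
  · simp only [h', Units.neg_smul, one_smul]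
    exact h.neg

theorem measurePreserving_pi_swap_units (ε : ι → ℤˣ) :
    MeasurePreserving (fun (z : ι → Ω × Ω) i => if ε i = 1 then z i else (z i).swap)
      (Measure.pi fun _ => μ.prod μ) (Measure.pi fun _ => μ.prod μ) := by
  refine measurePreserving_pi (f := fun i (w : Ω × Ω) => if ε i = 1 then w else w.swap) _ _
    fun i => ?_
  by_cases h : ε i = 1
  · simp only [h, if_true]
    exact MeasurePreserving.id _
  · simpa [h] using Measure.measurePreserving_swap

/-- Swapping the two copies of the i-th sample preserves the law and negates g(z_i.1) − g(z_i.2). -/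
theorem integral_exp_mul_norm_sum_sub_eq {g : Ω → B} (hg : StronglyMeasurable g) (s : ℝ)
    (ε : ι → ℤˣ) :
    ∫ z : ι → Ω × Ω, Real.exp (s * ‖∑ i, g (z i).1 - ∑ i, g (z i).2‖)
        ∂(Measure.pi fun _ => μ.prod μ) =
      ∫ z : ι → Ω × Ω, Real.exp (s * ‖∑ i, ε i • g (z i).1 - ∑ i, ε i • g (z i).2‖)
        ∂(Measure.pi fun _ => μ.prod μ) := by
  have hm : Measurable fun (z : ι → Ω × Ω) i => if ε i = 1 then z i else (z i).swap :=
    (measurePreserving_pi_swap_units (μ := μ) ε).measurable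
  have hg1 (i : ι) : StronglyMeasurable fun z : ι → Ω × Ω => g (z i).1 :=
    hg.comp_measurable (measurable_fst.comp (measurable_pi_apply i))
  have hg2 (i : ι) : StronglyMeasurable fun z : ι → Ω × Ω => g (z i).2 :=
    hg.comp_measurable (measurable_snd.comp (measurable_pi_apply i))
  rw [← (measurePreserving_pi_swap_units (μ := μ) ε).map_eq, integral_map hm.aemeasurable,
    (measurePreserving_pi_swap_units (μ := μ) ε).map_eq]
  · refine integral_congr_ae (Filter.Eventually.of_forall fun z => ?_)
    dsimp only
    rw [← Finset.sum_sub_distrib, ← Finset.sum_sub_distrib]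
    congr 3
    refine Finset.sum_congr rfl fun i _ => ?_
    rcases Int.units_eq_one_or (ε i) with h | h
    · simp [h]
    · simp [h, show (-1 : ℤˣ) ≠ 1 by decide]
      abel
  · refine (Real.continuous_exp.comp_stronglyMeasurable (StronglyMeasurable.const_mul ?_
      s)).aestronglyMeasurable
    exact ((Finset.stronglyMeasurable_fun_sum _ fun i _ => hg1 i).sub
      (Finset.stronglyMeasurable_fun_sum _ fun i _ => hg2 i)).norm

/-- Symmetrization of the exponential moments of the norm of a sum of independent and identically
distributed bounded random elements of a Banach space. -/
theorem integral_exp_norm_sum_sub_le [NormedSpace ℝ B] [CompleteSpace B] [DecidableEq ι] {g : Ω → B} (hg : StronglyMeasurable g)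
    {C : ℝ} (hC : ∀ x, ‖g x‖ ≤ C) {s : ℝ} (hs : 0 ≤ s) :
    Fintype.card (ι → ℤˣ) * ∫ x : ι → Ω,
        Real.exp (s * ‖∑ i, g (x i) - (Fintype.card ι : ℝ) • ∫ w, g w ∂μ‖)
          ∂(Measure.pi fun _ => μ) ≤
      ∑ ε : ι → ℤˣ, ∫ x : ι → Ω, Real.exp (2 * s * ‖∑ i, ε i • g (x i)‖)
        ∂(Measure.pi fun _ => μ) := by
  have hgi : Integrable g μ :=
    Integrable.of_bound hg.aestronglyMeasurable C (Filter.Eventually.of_forall hC)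
  have hsum : StronglyMeasurable fun x : ι → Ω => ∑ i, g (x i) := by
    simpa using stronglyMeasurable_sum_units_smul hg (1 : ι → ℤˣ)
  have hsumC (x : ι → Ω) : ‖∑ i, g (x i)‖ ≤ Fintype.card ι * C := by
    simpa using norm_sum_units_smul_le hC (1 : ι → ℤˣ) x
  have hmean : ∫ y : ι → Ω, ∑ i, g (y i) ∂(Measure.pi fun _ => μ) =
      (Fintype.card ι : ℝ) • ∫ w, g w ∂μ := by
    rw [integral_finsetSum _ fun i _ => integrable_comp_eval (μ := fun _ : ι => μ) hgi]
    simp [integral_comp_eval (μ := fun _ : ι => μ) hgi.aestronglyMeasurable, Nat.cast_smul_eq_nsmul]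
  -- the doubled sample
  have hF : StronglyMeasurable fun p : (ι → Ω) × (ι → Ω) => ∑ i, g (p.1 i) - ∑ i, g (p.2 i) :=
    (hsum.comp_measurable measurable_fst).sub (hsum.comp_measurable measurable_snd)
  have hFC (p : (ι → Ω) × (ι → Ω)) :
      ‖∑ i, g (p.1 i) - ∑ i, g (p.2 i)‖ ≤ Fintype.card ι * C + Fintype.card ι * C :=
    (norm_sub_le _ _).trans (add_le_add (hsumC _) (hsumC _))
  have hFi := integrable_exp_mul_norm_of_bounded
    (P := (Measure.pi fun _ : ι => μ).prod (Measure.pi fun _ : ι => μ)) hF hFC hs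
  -- The mean is an average over an independent copy of the sample, and Jensen moves that average
  -- outside the exponential.
  have hstep1 : ∫ x : ι → Ω, Real.exp (s * ‖∑ i, g (x i) - (Fintype.card ι : ℝ) • ∫ w, g w ∂μ‖)
        ∂(Measure.pi fun _ => μ) ≤
      ∫ z : ι → Ω × Ω, Real.exp (s * ‖∑ i, g (z i).1 - ∑ i, g (z i).2‖)
        ∂(Measure.pi fun _ => μ.prod μ) := by
    have hmp := measurePreserving_arrowProdEquivProdArrow Ω Ω ι (fun _ => μ) (fun _ => μ)
    have e1 := hmp.integral_comp' fun p : (ι → Ω) × (ι → Ω) =>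
      Real.exp (s * ‖∑ i, g (p.1 i) - ∑ i, g (p.2 i)‖)
    refine le_of_le_of_eq ?_ e1.symm
    rw [integral_prod _ hFi]
    refine integral_mono_of_nonneg (Filter.Eventually.of_forall fun x => (Real.exp_pos _).le)
      hFi.integral_prod_left (Filter.Eventually.of_forall fun x => ?_)
    dsimp only
    rw [← hmean]
    refine (convexOn_exp_mul_norm_sub hs (∑ i, g (x i))).map_integral_le
      (μ := Measure.pi fun _ : ι => μ) (f := fun y : ι → Ω => ∑ i, g (y i))
      (by fun_prop) isClosed_univ (Filter.Eventually.of_forall fun _ => Set.mem_univ _) ?_ ?_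
    · exact Integrable.of_bound hsum.aestronglyMeasurable _ (Filter.Eventually.of_forall hsumC)
    · exact integrable_exp_mul_norm_of_bounded (stronglyMeasurable_const.sub hsum)
        (fun y => hFC (x, y)) hs
  have hfst : MeasurePreserving (fun (z : ι → Ω × Ω) i => (z i).1)
      (Measure.pi fun _ => μ.prod μ) (Measure.pi fun _ => μ) :=
    measurePreserving_pi _ _ fun i => measurePreserving_fst
  have hsnd : MeasurePreserving (fun (z : ι → Ω × Ω) i => (z i).2)
      (Measure.pi fun _ => μ.prod μ) (Measure.pi fun _ => μ) :=
    measurePreserving_pi _ _ fun i => measurePreserving_snd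
  have hstep2 (ε : ι → ℤˣ) :
      ∫ z : ι → Ω × Ω, Real.exp (s * ‖∑ i, g (z i).1 - ∑ i, g (z i).2‖)
        ∂(Measure.pi fun _ => μ.prod μ) ≤
      ∫ x : ι → Ω, Real.exp (2 * s * ‖∑ i, ε i • g (x i)‖) ∂(Measure.pi fun _ => μ) := by
    rw [integral_exp_mul_norm_sum_sub_eq hg s ε]
    have hR := stronglyMeasurable_sum_units_smul (ι := ι) hg ε
    have hRi := integrable_exp_mul_norm_of_bounded (P := Measure.pi fun _ : ι => μ) hR
      (norm_sum_units_smul_le hC ε) (mul_nonneg zero_le_two hs)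
    have i1 : Integrable (fun z : ι → Ω × Ω => Real.exp (2 * s * ‖∑ i, ε i • g (z i).1‖))
        (Measure.pi fun _ => μ.prod μ) := hfst.integrable_comp_of_integrable hRi
    have i2 : Integrable (fun z : ι → Ω × Ω => Real.exp (2 * s * ‖∑ i, ε i • g (z i).2‖))
        (Measure.pi fun _ => μ.prod μ) := hsnd.integrable_comp_of_integrable hRi
    have e1 : ∫ z : ι → Ω × Ω, Real.exp (2 * s * ‖∑ i, ε i • g (z i).1‖)
        ∂(Measure.pi fun _ => μ.prod μ) =
        ∫ x : ι → Ω, Real.exp (2 * s * ‖∑ i, ε i • g (x i)‖) ∂(Measure.pi fun _ => μ) := by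
      rw [← hfst.map_eq, integral_map hfst.measurable.aemeasurable]
      rw [hfst.map_eq]
      exact hRi.aestronglyMeasurable
    have e2 : ∫ z : ι → Ω × Ω, Real.exp (2 * s * ‖∑ i, ε i • g (z i).2‖)
        ∂(Measure.pi fun _ => μ.prod μ) =
        ∫ x : ι → Ω, Real.exp (2 * s * ‖∑ i, ε i • g (x i)‖) ∂(Measure.pi fun _ => μ) := by
      rw [← hsnd.map_eq, integral_map hsnd.measurable.aemeasurable]
      rw [hsnd.map_eq]
      exact hRi.aestronglyMeasurable
    have hle : ∫ z : ι → Ω × Ω, Real.exp (s * ‖∑ i, ε i • g (z i).1 - ∑ i, ε i • g (z i).2‖)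
        ∂(Measure.pi fun _ => μ.prod μ) ≤
        ∫ z : ι → Ω × Ω, (Real.exp (2 * s * ‖∑ i, ε i • g (z i).1‖) +
          Real.exp (2 * s * ‖∑ i, ε i • g (z i).2‖)) / 2 ∂(Measure.pi fun _ => μ.prod μ) := by
      refine integral_mono_of_nonneg (Filter.Eventually.of_forall fun x => (Real.exp_pos _).le)
        ((i1.add i2).div_const 2) (Filter.Eventually.of_forall fun z => ?_)
      dsimp only
      set a := ‖∑ i, ε i • g (z i).1‖
      set b := ‖∑ i, ε i • g (z i).2‖
      -- The two copies decouple by the triangle inequality and 2xy ≤ x² + y²; this is where s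
      -- becomes 2s.
      have h1 : Real.exp (s * ‖∑ i, ε i • g (z i).1 - ∑ i, ε i • g (z i).2‖) ≤
          Real.exp (s * a) * Real.exp (s * b) := by
        rw [← Real.exp_add, ← mul_add]
        exact Real.exp_le_exp.2 (mul_le_mul_of_nonneg_left (norm_sub_le _ _) hs)
      have h2 : Real.exp (2 * s * a) = Real.exp (s * a) ^ 2 := by
        rw [← Real.exp_nat_mul]; congr 1; push_cast; ring
      have h3 : Real.exp (2 * s * b) = Real.exp (s * b) ^ 2 := by
        rw [← Real.exp_nat_mul]; congr 1; push_cast; ring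
      rw [h2, h3]
      nlinarith [sq_nonneg (Real.exp (s * a) - Real.exp (s * b))]
    refine hle.trans_eq ?_
    rw [integral_div, integral_add i1 i2, e1, e2]
    ring
  calc _ ≤ ∑ _ε : ι → ℤˣ, ∫ z : ι → Ω × Ω,
        Real.exp (s * ‖∑ i, g (z i).1 - ∑ i, g (z i).2‖) ∂(Measure.pi fun _ => μ.prod μ) := by
        rw [Finset.sum_const, Finset.card_univ, nsmul_eq_mul]
        exact mul_le_mul_of_nonneg_left hstep1 (Nat.cast_nonneg _)
    _ ≤ _ := Finset.sum_le_sum fun ε _ => hstep2 ε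

end Symmetrization

/-! ### Self-bounding exponential moment and tail bound -/

section Concentration

/-- Trades the factor n^(4/3) for n at the price of weakening the rate from 1/12 to 1/21. As p ≤ 1,
only the case where the target bound is below 1 matters, and there the exponential is large enough
to absorb the surplus. -/
theorem tail_le_of_pow_three_le {n : ℕ} (hn : 1 ≤ n) {p ρ : ℝ} (hp : p ≤ 1)
    (hρ0 : 0 ≤ ρ) (hρ : ρ ≤ n) (h : p ^ 3 ≤ (2 * n) ^ 4 * Real.exp (-(ρ / 4))) :
    p ≤ (2 : ℝ) ^ (3 / 4 : ℝ) * n * Real.exp (-(ρ / 21)) := by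
  set c : ℝ := (2 : ℝ) ^ (3 / 4 : ℝ) with hc
  have hc0 : 0 < c := Real.rpow_pos_of_pos two_pos _
  have hc4 : c ^ 4 = 8 := by
    rw [hc, ← Real.rpow_natCast, ← Real.rpow_mul two_pos.le]
    norm_num
  have hc1 : 1 ≤ c := Real.one_le_rpow one_le_two (by norm_num)
  -- 84 = lcm(4, 21), so both exponentials are integer powers of x.
  set x : ℝ := Real.exp (ρ / 84) with hx
  have hx1 : 1 ≤ x := Real.one_le_exp (by positivity)
  have hx0 : 0 < x := Real.exp_pos _
  have e4 : Real.exp (-(ρ / 21)) = (x ^ 4)⁻¹ := by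
    rw [Real.exp_neg, hx, ← Real.exp_nat_mul]; congr 2; push_cast; ring
  have e21 : Real.exp (-(ρ / 4)) = (x ^ 21)⁻¹ := by
    rw [Real.exp_neg, hx, ← Real.exp_nat_mul]; congr 2; push_cast; ring
  have hn1 : (1 : ℝ) ≤ n := by exact_mod_cast hn
  rw [e4]
  rw [e21] at h
  rcases le_or_gt (x ^ 4) (c * n) with hlt | hgt
  · refine hp.trans ?_
    rw [← div_eq_mul_inv, le_div_iff₀ (by positivity), one_mul]
    exact hlt
  -- For n = 1 the bound ρ ≤ 1 gives x^84 ≤ e < 3, whereas x^4 > c would force x^16 ≥ c^4 = 8.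
  have hn2 : 2 ≤ n := by
    by_contra hlt
    obtain rfl : n = 1 := by omega
    have h84 : x ^ 84 ≤ 3 := by
      have : x ^ 84 = Real.exp ρ := by
        rw [hx, ← Real.exp_nat_mul]; congr 1; push_cast; ring
      rw [this]
      refine (Real.exp_le_exp.2 (hρ.trans_eq Nat.cast_one)).trans ?_
      exact Real.exp_one_lt_three.le
    have h1 : c ≤ x ^ 4 := by simpa using hgt.le
    have h2 : c ^ 4 ≤ (x ^ 4) ^ 4 := pow_le_pow_left₀ hc0.le h1 4
    have h3 : (x ^ 4) ^ 4 ≤ x ^ 84 := by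
      rw [← pow_mul]; exact pow_le_pow_right₀ hx1 (by norm_num)
    linarith
  have hn2' : (2 : ℝ) ≤ n := by exact_mod_cast hn2
  have hx9 : 16 * n ≤ c ^ 3 * x ^ 9 := by
    have h8 : (c * n) ^ 2 ≤ x ^ 9 :=
      calc (c * n) ^ 2 ≤ (x ^ 4) ^ 2 := pow_le_pow_left₀ (by positivity) hgt.le 2
        _ = x ^ 8 := by ring
        _ ≤ x ^ 9 := pow_le_pow_right₀ hx1 (by norm_num)
    calc (16 : ℝ) * n ≤ 8 * 1 * (n * n) := by nlinarith
      _ ≤ 8 * c * (n * n) := by gcongr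
      _ = c ^ 3 * (c * n) ^ 2 := by rw [← hc4]; ring
      _ ≤ _ := by gcongr
  refine le_of_pow_le_pow_left₀ (n := 3) (by norm_num) (by positivity) (h.trans ?_)
  rw [← div_eq_mul_inv, ← div_eq_mul_inv, div_pow, div_le_div_iff₀ (by positivity) (by positivity)]
  calc (2 * (n : ℝ)) ^ 4 * (x ^ 4) ^ 3 = (16 * n) * (n ^ 3 * x ^ 12) := by ring
    _ ≤ (c ^ 3 * x ^ 9) * (n ^ 3 * x ^ 12) := by gcongr
    _ = _ := by ring

theorem continuous_rankOne_self {H : Type*} [NormedAddCommGroup H] [InnerProductSpace ℂ H] :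
    Continuous fun h : H => InnerProductSpace.rankOne ℂ h h :=
  ((ContinuousLinearMap.smulRightL ℂ H H).continuous.comp
    (innerSL ℂ (E := H)).continuous).clm_apply continuous_id

variable {Ω : Type*} [MeasurableSpace Ω] {μ : Measure Ω} [IsProbabilityMeasure μ]
  {H : Type*} [NormedAddCommGroup H] [InnerProductSpace ℂ H]

theorem stronglyMeasurable_rankOne_self {v : Ω → H} (hv : StronglyMeasurable v) :
    StronglyMeasurable fun x => InnerProductSpace.rankOne ℂ (v x) (v x) :=
  continuous_rankOne_self.comp_stronglyMeasurable hv

variable [CompleteSpace H]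

theorem integral_exp_norm_sum_rankOne_pow_three_le {v : Ω → H} (hv : StronglyMeasurable v)
    {M L t : ℝ} (hM : 0 < M) (hvM : ∀ x, ‖v x‖ ^ 2 ≤ M)
    (hL : ‖∫ w, InnerProductSpace.rankOne ℂ (v w) (v w) ∂μ‖ ≤ L)
    {n : ℕ} (hn : 1 ≤ n) (ht : 0 < t) (ht1 : t ≤ 1) :
    (∫ x : Fin n → Ω, Real.exp (t / (8 * M) *
      ‖∑ i, InnerProductSpace.rankOne ℂ (v (x i)) (v (x i)) -
        (n : ℝ) • ∫ w, InnerProductSpace.rankOne ℂ (v w) (v w) ∂μ‖)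
        ∂(Measure.pi fun _ => μ)) ^ 3 ≤ (2 * n) ^ 4 * Real.exp (n * t ^ 2 * L / M / 8) := by
  have : Nonempty (Fin n) := ⟨⟨0, hn⟩⟩
  set g : Ω → H →L[ℂ] H := fun w => InnerProductSpace.rankOne ℂ (v w) (v w) with hg
  have hgm : StronglyMeasurable g := stronglyMeasurable_rankOne_self hv
  have hgC (x) : ‖g x‖ ≤ M := by
    rw [hg]; dsimp only; rw [InnerProductSpace.norm_rankOne, ← sq]; exact hvM x
  set s : ℝ := t / (8 * M) with hs
  have hs0 : 0 ≤ s := by positivity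
  set Λ := ∫ w, g w ∂μ with hΛ
  set P : Measure (Fin n → Ω) := Measure.pi fun _ => μ with hP
  let Z : (Fin n → Ω) → (H →L[ℂ] H) := fun x => ∑ i, g (x i) - (n : ℝ) • Λ
  have hZm : StronglyMeasurable Z := by
    refine StronglyMeasurable.sub ?_ stronglyMeasurable_const
    simpa using stronglyMeasurable_sum_units_smul hgm (1 : Fin n → ℤˣ)
  have hZC (x) : ‖Z x‖ ≤ n * M + ‖(n : ℝ) • Λ‖ := by
    refine (norm_sub_le _ _).trans (add_le_add_left ?_ _)
    simpa using norm_sum_units_smul_le hgC (1 : Fin n → ℤˣ) x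
  set Q := ∫ x, Real.exp (s * ‖Z x‖) ∂P with hQ
  set q := ∫ x, Real.exp (s / 4 * ‖Z x‖) ∂P with hq
  have hQi : Integrable (fun x => Real.exp (s * ‖Z x‖)) P :=
    integrable_exp_mul_norm_of_bounded hZm hZC hs0
  have hqi : Integrable (fun x => Real.exp (s / 4 * ‖Z x‖)) P :=
    integrable_exp_mul_norm_of_bounded hZm hZC (by positivity)
  have hpow (x) : Real.exp (s / 4 * ‖Z x‖) ^ 4 = Real.exp (s * ‖Z x‖) := by
    rw [← Real.exp_nat_mul]; congr 1; push_cast; ring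
  have hqQ : q ^ 4 ≤ Q := by
    have h := (Even.convexOn_pow (𝕜 := ℝ) (n := 4) (by decide)).map_integral_le (μ := P)
      (f := fun x => Real.exp (s / 4 * ‖Z x‖)) (by fun_prop) isClosed_univ
      (Filter.Eventually.of_forall fun _ => Set.mem_univ _) hqi
      (hQi.congr (Filter.Eventually.of_forall fun x => (hpow x).symm))
    simpa only [hpow] using h
  have hq0 : 0 ≤ q := integral_nonneg fun x => (Real.exp_pos _).le
  have hL0 : 0 ≤ L := (norm_nonneg _).trans hL
  set ρ := n * t ^ 2 * L / M with hρ
  have hpt (x : Fin n → Ω) : ∑ ε : Fin n → ℤˣ, Real.exp (2 * s * ‖∑ i, ε i • g (x i)‖) ≤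
      Fintype.card (Fin n → ℤˣ) *
        (2 * n * Real.exp (ρ / 32) * Real.exp (s / 4 * ‖Z x‖)) := by
    have h1 := sum_signs_cosh_norm_rankOne_le (fun i => v (x i)) (fun i => hvM (x i)) (2 * s)
    have h2 (y : ℝ) : Real.exp y ≤ 2 * Real.cosh y := by
      rw [Real.cosh_eq]; have := Real.exp_pos (-y); linarith
    -- With s = t/(8M) one has 2s²M = ts/4 and 2s²M·nL = ρ/32; then t ≤ 1 is used.
    have h3 : (2 * s) ^ 2 * (M * ‖∑ i, g (x i)‖) / 2 ≤ ρ / 32 + s / 4 * ‖Z x‖ := by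
      have h4 : ‖∑ i, g (x i)‖ ≤ ‖Z x‖ + n * L := by
        have : ∑ i, g (x i) = Z x + (n : ℝ) • Λ := by simp [Z]
        rw [this]
        refine (norm_add_le _ _).trans (add_le_add_right ?_ _)
        rw [norm_smul, Real.norm_natCast]
        exact mul_le_mul_of_nonneg_left hL (Nat.cast_nonneg _)
      have h5 : (2 * s) ^ 2 * (M * ‖∑ i, g (x i)‖) / 2 ≤
          (2 * s) ^ 2 * (M * (‖Z x‖ + n * L)) / 2 := by gcongr
      have h6 : (2 * s) ^ 2 * (M * (‖Z x‖ + n * L)) / 2 =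
          ρ / 32 + t * (s / 4 * ‖Z x‖) := by
        rw [hρ, hs]; field_simp; ring
      have h7 : t * (s / 4 * ‖Z x‖) ≤ s / 4 * ‖Z x‖ :=
        mul_le_of_le_one_left (by positivity) ht1
      linarith
    calc _ ≤ ∑ ε : Fin n → ℤˣ, 2 * Real.cosh (2 * s * ‖∑ i, ε i • g (x i)‖) :=
          Finset.sum_le_sum fun ε _ => h2 _
      _ ≤ 2 * (Fintype.card (Fin n → ℤˣ) * Fintype.card (Fin n) *
          Real.exp ((2 * s) ^ 2 * (M * ‖∑ i, g (x i)‖) / 2)) := by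
          rw [← Finset.mul_sum]
          exact mul_le_mul_of_nonneg_left h1 zero_le_two
      _ ≤ 2 * (Fintype.card (Fin n → ℤˣ) * Fintype.card (Fin n) *
          Real.exp (ρ / 32 + s / 4 * ‖Z x‖)) := by gcongr
      _ = _ := by rw [Real.exp_add, Fintype.card_fin]; ring
  have hcard : (0 : ℝ) < Fintype.card (Fin n → ℤˣ) := by exact_mod_cast Fintype.card_pos
  have hsym : Q ≤ 2 * n * Real.exp (ρ / 32) * q := by
    have h := integral_exp_norm_sum_sub_le (ι := Fin n) (μ := μ) hgm hgC hs0
    rw [← integral_finsetSum _ fun ε _ => integrable_exp_mul_norm_of_bounded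
      (stronglyMeasurable_sum_units_smul hgm ε) (norm_sum_units_smul_le hgC ε)
      (mul_nonneg zero_le_two hs0), Fintype.card_fin (n := n)] at h
    refine le_of_mul_le_mul_left (h.trans ?_) hcard
    rw [← integral_const_mul, ← integral_const_mul]
    exact integral_mono_of_nonneg
      (Filter.Eventually.of_forall fun x => Finset.sum_nonneg fun _ _ => (Real.exp_pos _).le)
      ((hqi.const_mul _).const_mul _) (Filter.Eventually.of_forall hpt)
  have hQ1 : 0 < Q := by
    rw [hQ]
    exact integral_exp_pos hQi
  -- The self-bounding step: Q ≤ a·q and q⁴ ≤ Q give Q⁴ ≤ a⁴Q, and Q > 0 cancels.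
  have h4 : Q ^ 4 ≤ (2 * n * Real.exp (ρ / 32)) ^ 4 * Q := by
    refine (pow_le_pow_left₀ hQ1.le hsym 4).trans ?_
    rw [mul_pow]
    exact mul_le_mul_of_nonneg_left hqQ (by positivity)
  have h5 : (2 * n * Real.exp (ρ / 32)) ^ 4 = (2 * n) ^ 4 * Real.exp (ρ / 8) := by
    rw [mul_pow, ← Real.exp_nat_mul]; congr 2; push_cast; ring
  rw [h5, pow_succ] at h4
  exact le_of_mul_le_mul_right h4 hQ1

/-- Concentration of sums of independent rank one operators with bounded norms. -/
theorem measureReal_lt_norm_sum_rankOne_sub_le {v : Ω → H} (hv : StronglyMeasurable v)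
    {M L t : ℝ} (hM : 0 < M) (hvM : ∀ x, ‖v x‖ ^ 2 ≤ M)
    (hL : ‖∫ w, InnerProductSpace.rankOne ℂ (v w) (v w) ∂μ‖ ≤ L) (hLM : L ≤ M)
    {n : ℕ} (hn : 1 ≤ n) (ht : 0 < t) (ht1 : t ≤ 1) :
    (Measure.pi fun _ : Fin n => μ).real {x | n * (t * L) <
      ‖∑ i, InnerProductSpace.rankOne ℂ (v (x i)) (v (x i)) -
        (n : ℝ) • ∫ w, InnerProductSpace.rankOne ℂ (v w) (v w) ∂μ‖} ≤
      (2 : ℝ) ^ (3 / 4 : ℝ) * n * Real.exp (-(n * t ^ 2 * L / (21 * M))) := by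
  have hQ3 := integral_exp_norm_sum_rankOne_pow_three_le hv hM hvM hL hn ht ht1
  have hgm := stronglyMeasurable_rankOne_self hv
  have hgC (x) : ‖InnerProductSpace.rankOne ℂ (v x) (v x)‖ ≤ M := by
    rw [InnerProductSpace.norm_rankOne, ← sq]; exact hvM x
  set Λ := ∫ w, InnerProductSpace.rankOne ℂ (v w) (v w) ∂μ with hΛ
  set P : Measure (Fin n → Ω) := Measure.pi fun _ => μ with hP
  set Z : (Fin n → Ω) → (H →L[ℂ] H) := fun x =>
    ∑ i, InnerProductSpace.rankOne ℂ (v (x i)) (v (x i)) - (n : ℝ) • Λ with hZ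
  have hZm : StronglyMeasurable Z := by
    refine StronglyMeasurable.sub ?_ stronglyMeasurable_const
    simpa using stronglyMeasurable_sum_units_smul hgm (1 : Fin n → ℤˣ)
  have hZC (x) : ‖Z x‖ ≤ n * M + ‖(n : ℝ) • Λ‖ := by
    refine (norm_sub_le _ _).trans (add_le_add_left ?_ _)
    simpa using norm_sum_units_smul_le hgC (1 : Fin n → ℤˣ) x
  have hL0 : 0 ≤ L := (norm_nonneg _).trans hL
  set s : ℝ := t / (8 * M) with hs
  have hs0 : 0 < s := by positivity
  set ρ := n * t ^ 2 * L / M with hρ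
  have hρ0 : 0 ≤ ρ := by positivity
  have hρn : ρ ≤ n := by
    rw [hρ, div_le_iff₀ hM, mul_assoc]
    refine mul_le_mul_of_nonneg_left ?_ (Nat.cast_nonneg _)
    exact (mul_le_of_le_one_left hL0 (pow_le_one₀ ht.le ht1)).trans hLM
  have hQi : Integrable (fun x => Real.exp (s * ‖Z x‖)) P :=
    integrable_exp_mul_norm_of_bounded hZm hZC hs0.le
  -- Markov's inequality; at the threshold n·t·L the exponent s·n·t·L equals ρ/8.
  have hmk : Real.exp (ρ / 8) * P.real {x | n * (t * L) < ‖Z x‖} ≤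
      ∫ x, Real.exp (s * ‖Z x‖) ∂P := by
    refine le_trans ?_ (mul_meas_ge_le_integral_of_nonneg
      (Filter.Eventually.of_forall fun x => (Real.exp_pos _).le) hQi (Real.exp (ρ / 8)))
    refine mul_le_mul_of_nonneg_left (measureReal_mono fun x hx => ?_) (Real.exp_pos _).le
    refine Real.exp_le_exp.2 ?_
    have h1 : s * (n * (t * L)) ≤ s * ‖Z x‖ := mul_le_mul_of_nonneg_left (le_of_lt hx) hs0.le
    have h2 : s * (n * (t * L)) = ρ / 8 := by rw [hs, hρ]; field_simp
    exact h2 ▸ h1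
  have hfin := tail_le_of_pow_three_le hn (p := P.real {x | n * (t * L) < ‖Z x‖})
    measureReal_le_one hρ0 hρn (by
      have h1 := (pow_le_pow_left₀ (by positivity) hmk 3).trans hQ3
      have h2 : Real.exp (ρ / 8) ^ 3 = Real.exp (ρ / 8) * Real.exp (ρ / 4) := by
        rw [← Real.exp_nat_mul, ← Real.exp_add]; congr 1; push_cast; ring
      rw [mul_pow, h2, mul_comm _ (Real.exp (ρ / 8)), mul_assoc] at h1
      have h3 := le_of_mul_le_mul_left h1 (Real.exp_pos _)
      rw [Real.exp_neg, ← div_eq_mul_inv, le_div_iff₀ (Real.exp_pos _), mul_comm]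
      exact h3)
  have : n * t ^ 2 * L / (21 * M) = ρ / 21 := by rw [hρ]; field_simp
  rw [this]
  exact hfin

end Concentration

/-! ### Weak and strong measurability -/

section SeparableHilbert

variable {H : Type*} [NormedAddCommGroup H] [InnerProductSpace ℂ H]
  [TopologicalSpace.SeparableSpace H]

/-- Orthonormal vectors are √2 apart, so balls of radius 1/2 around them are disjoint. -/
theorem countable_of_orthonormal {ι : Type*} {b : ι → H} (hb : Orthonormal ℂ b) :
    Countable ι := by
  refine Pairwise.countable_of_isOpen_disjoint (s := fun i => Metric.ball (b i) (1 / 2))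
    (fun i j hij => Metric.ball_disjoint_ball ?_) (fun i => Metric.isOpen_ball)
    (fun i => Metric.nonempty_ball.2 (by norm_num))
  have h : ‖b i - b j‖ ^ 2 = 2 := by
    rw [norm_sub_sq (𝕜 := ℂ), hb.1 i, hb.1 j, hb.2 hij]
    norm_num
  rw [dist_eq_norm]
  nlinarith [norm_nonneg (b i - b j)]

/-- Pettis' theorem in a Hilbert space: u is the pointwise limit of its partial sums in a countable
Hilbert basis. -/
theorem aestronglyMeasurable_of_inner [CompleteSpace H] {X : Type*} [MeasurableSpace X]
    {ϱ : Measure X} {u : X → H} (hu : ∀ f : H, AEStronglyMeasurable (fun x => ⟪f, u x⟫_ℂ) ϱ) :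
    AEStronglyMeasurable u ϱ := by
  obtain ⟨w, b, -⟩ := exists_hilbertBasis ℂ H
  have : Countable w := countable_of_orthonormal b.orthonormal
  refine aestronglyMeasurable_of_tendsto_ae Filter.atTop
    (f := fun (F : Finset w) x => ∑ i ∈ F, b.repr (u x) i • b i) (fun F => ?_)
    (Filter.Eventually.of_forall fun x => b.hasSum_repr (u x))
  refine Finset.aestronglyMeasurable_fun_sum _ fun i _ => ?_
  simp only [b.repr_apply_apply]
  exact (hu (b i)).smul_const (b i)

end SeparableHilbert

/-! ### From kernel functions to random rank-one operators -/

section RandomNodes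

variable {X : Type*} {H : Type*} [NormedAddCommGroup H] [InnerProductSpace ℂ H]
  [CompleteSpace H] [RKHS ℂ H X ℂ]

theorem inner_kerFun_one (f : H) (x : X) : ⟪RKHS.kerFun H x 1, f⟫_ℂ = f x := by
  rw [RKHS.kerFun_inner]
  simp [RCLike.inner_apply]

variable [MeasurableSpace X] {ϱ : Measure X}

theorem aestronglyMeasurable_kerFun [TopologicalSpace.SeparableSpace H]
    (hmeas : ∀ f : H, AEStronglyMeasurable (fun x => f x) ϱ) :
    AEStronglyMeasurable (fun x => RKHS.kerFun H x (1 : ℂ)) ϱ := by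
  refine aestronglyMeasurable_of_inner fun f => ?_
  simp_rw [← inner_conj_symm f, inner_kerFun_one]
  exact Complex.continuous_conj.comp_aestronglyMeasurable (hmeas f)

theorem samplingDensity_nonneg (x : X) : 0 ≤ samplingDensity H ϱ x :=
  div_nonneg (by rw [kernelFun_self_re]; positivity) (kernelTrace_nonneg H ϱ)

variable (H ϱ) in
/-- The kernel function `K(·, x)` divided by the square root of the sampling density. -/
noncomputable def weightedKerFun (x : X) : H :=
  (((Real.sqrt (samplingDensity H ϱ x))⁻¹ : ℝ) : ℂ) • RKHS.kerFun H x (1 : ℂ)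

theorem inner_weightedKerFun (f : H) (x : X) :
    ⟪weightedKerFun H ϱ x, f⟫_ℂ = (((Real.sqrt (samplingDensity H ϱ x))⁻¹ : ℝ) : ℂ) * f x := by
  rw [weightedKerFun, inner_smul_left, inner_kerFun_one, Complex.conj_ofReal]

/-- Where ν(x) = 0 both sides are 0 by the convention for division by 0, so no node has to be
excluded. -/
theorem norm_sq_inner_weightedKerFun (f : H) (x : X) :
    ‖⟪weightedKerFun H ϱ x, f⟫_ℂ‖ ^ 2 = ‖f x‖ ^ 2 / samplingDensity H ϱ x := by
  rw [inner_weightedKerFun, norm_mul, mul_pow, Complex.norm_real, Real.norm_eq_abs, sq_abs,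
    inv_pow, Real.sq_sqrt (samplingDensity_nonneg x), div_eq_inv_mul]

theorem norm_sq_weightedKerFun_le (x : X) :
    ‖weightedKerFun H ϱ x‖ ^ 2 ≤ kernelTrace H ϱ := by
  rw [weightedKerFun, norm_smul, mul_pow, Complex.norm_real, Real.norm_eq_abs, sq_abs,
    inv_pow, Real.sq_sqrt (samplingDensity_nonneg x), ← kernelFun_self_re, samplingDensity, inv_div]
  rcases eq_or_ne (kernelFun H x x).re 0 with h | h
  · simp [h, kernelTrace_nonneg H ϱ]
  · rw [div_mul_cancel₀ _ h]

theorem aemeasurable_samplingDensity (htr : FiniteTrace H ϱ) :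
    AEMeasurable (samplingDensity H ϱ) ϱ :=
  (Integrable.aestronglyMeasurable htr).aemeasurable.div_const _

theorem aestronglyMeasurable_weightedKerFun [TopologicalSpace.SeparableSpace H]
    (hmeas : ∀ f : H, AEStronglyMeasurable (fun x => f x) ϱ) (htr : FiniteTrace H ϱ) :
    AEStronglyMeasurable (weightedKerFun H ϱ) (samplingMeasure H ϱ) := by
  refine AEStronglyMeasurable.mono_ac (withDensity_absolutelyContinuous _ _) ?_
  refine AEStronglyMeasurable.smul ?_ (aestronglyMeasurable_kerFun hmeas)
  exact (Complex.measurable_ofReal.comp_aemeasurable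
    (Real.continuous_sqrt.measurable.comp_aemeasurable
      (aemeasurable_samplingDensity htr)).inv).aestronglyMeasurable

theorem integrable_rankOne_weightedKerFun [TopologicalSpace.SeparableSpace H]
    (hmeas : ∀ f : H, AEStronglyMeasurable (fun x => f x) ϱ) (htr : FiniteTrace H ϱ)
    [IsProbabilityMeasure (samplingMeasure H ϱ)] :
    Integrable (fun x => InnerProductSpace.rankOne ℂ (weightedKerFun H ϱ x)
      (weightedKerFun H ϱ x)) (samplingMeasure H ϱ) := by
  refine Integrable.of_bound (C := kernelTrace H ϱ) ?_ (Filter.Eventually.of_forall fun x => ?_)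
  · exact (continuous_rankOne_self).comp_aestronglyMeasurable
      (aestronglyMeasurable_weightedKerFun hmeas htr)
  · rw [InnerProductSpace.norm_rankOne, ← sq]
    exact norm_sq_weightedKerFun_le x

theorem inner_embL2 (hmeas : ∀ f : H, AEStronglyMeasurable (fun x => f x) ϱ)
    (htr : FiniteTrace H ϱ) (g f : H) :
    ⟪embL2 hmeas htr g, embL2 hmeas htr f⟫_ℂ = ∫ x, ⟪g x, f x⟫_ℂ ∂ϱ := by
  rw [L2.inner_def]
  refine integral_congr_ae ?_
  filter_upwards [(memLp_two_of_finiteTrace hmeas htr g).coeFn_toLp,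
    (memLp_two_of_finiteTrace hmeas htr f).coeFn_toLp] with x hg hf
  rw [← hg, ← hf]
  rfl

theorem norm_sq_embL2 (hmeas : ∀ f : H, AEStronglyMeasurable (fun x => f x) ϱ)
    (htr : FiniteTrace H ϱ) (f : H) : ‖embL2 hmeas htr f‖ ^ 2 = ∫ x, ‖f x‖ ^ 2 ∂ϱ :=
  norm_sq_toLp (memLp_two_of_finiteTrace hmeas htr f)

theorem norm_sq_embL2_le_kernelTrace (hmeas : ∀ f : H, AEStronglyMeasurable (fun x => f x) ϱ)
    (htr : FiniteTrace H ϱ) : ‖embL2 hmeas htr‖ ^ 2 ≤ kernelTrace H ϱ := by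
  rw [← Real.sq_sqrt (kernelTrace_nonneg H ϱ)]
  exact pow_le_pow_left₀ (norm_nonneg _)
    (LinearMap.mkContinuous_norm_le _ (Real.sqrt_nonneg _) _) 2

/-- The second moment operator of the weighted kernel functions is `Id* Id`. -/
theorem integral_rankOne_weightedKerFun [TopologicalSpace.SeparableSpace H]
    (hmeas : ∀ f : H, AEStronglyMeasurable (fun x => f x) ϱ) (htr : FiniteTrace H ϱ)
    (hpos : 0 < kernelTrace H ϱ) [IsProbabilityMeasure (samplingMeasure H ϱ)] :
    ∫ x, InnerProductSpace.rankOne ℂ (weightedKerFun H ϱ x) (weightedKerFun H ϱ x)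
      ∂(samplingMeasure H ϱ) =
    (embL2 hmeas htr).adjoint ∘L embL2 hmeas htr := by
  have hint := integrable_rankOne_weightedKerFun hmeas htr
  refine ContinuousLinearMap.ext fun f => ext_inner_left ℂ fun g => ?_
  rw [ContinuousLinearMap.comp_apply, ContinuousLinearMap.adjoint_inner_right, inner_embL2,
    ContinuousLinearMap.integral_apply hint, ← integral_inner (hint.apply_continuousLinearMap f),
    samplingMeasure, integral_withDensity_eq_integral_toReal_smul₀
      (aemeasurable_samplingDensity htr).ennreal_ofReal
      (Filter.Eventually.of_forall fun x => ENNReal.ofReal_lt_top)]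
  refine integral_congr_ae (Filter.Eventually.of_forall fun x => ?_)
  dsimp only
  rw [ENNReal.toReal_ofReal (samplingDensity_nonneg x), InnerProductSpace.rankOne_apply,
    inner_smul_right, ← inner_conj_symm g, inner_weightedKerFun, inner_weightedKerFun]
  -- Zeros of ν lose nothing in the ϱ-integral: there K(x,x) = 0, so every function of H vanishes.
  have hfx : ∀ h : H, samplingDensity H ϱ x = 0 → h x = 0 := by
    intro h hx
    have h1 := norm_sq_apply_le h x
    rw [samplingDensity, div_eq_zero_iff, or_iff_left hpos.ne'] at hx
    rw [hx, mul_zero] at h1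
    exact norm_eq_zero.1 (pow_eq_zero_iff two_ne_zero |>.1 (le_antisymm h1 (sq_nonneg _)))
  rcases eq_or_ne (samplingDensity H ϱ x) 0 with h0 | h0
  · simp [hfx f h0]
  · have hsq : ((Real.sqrt (samplingDensity H ϱ x) : ℝ) : ℂ) ^ 2 =
        ((samplingDensity H ϱ x : ℝ) : ℂ) := by
      rw [← Complex.ofReal_pow, Real.sq_sqrt (samplingDensity_nonneg x)]
    have hne : ((Real.sqrt (samplingDensity H ϱ x) : ℝ) : ℂ) ≠ 0 := by
      rw [Complex.ofReal_ne_zero]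
      exact (Real.sqrt_pos.2 ((samplingDensity_nonneg x).lt_of_ne' h0)).ne'
    rw [map_mul, Complex.conj_ofReal, RCLike.inner_apply, Complex.real_smul, ← hsq,
      Complex.ofReal_inv]
    field_simp

/-- The deviation for f is, up to sign, the quadratic form ⟨f, Tf⟩/n, which is at most ‖T‖/n on the
unit ball. -/
theorem weightedDiscrError_le (hmeas : ∀ f : H, AEStronglyMeasurable (fun x => f x) ϱ)
    (htr : FiniteTrace H ϱ) {n : ℕ} (hn : 1 ≤ n) (xs : Fin n → X) :
    n * weightedDiscrError H ϱ xs ≤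
      ‖∑ i, InnerProductSpace.rankOne ℂ (weightedKerFun H ϱ (xs i)) (weightedKerFun H ϱ (xs i)) -
        (n : ℝ) • ((embL2 hmeas htr).adjoint ∘L embL2 hmeas htr)‖ := by
  set T := ∑ i, InnerProductSpace.rankOne ℂ (weightedKerFun H ϱ (xs i))
    (weightedKerFun H ϱ (xs i)) - (n : ℝ) • ((embL2 hmeas htr).adjoint ∘L embL2 hmeas htr) with hT
  have hn0 : (0 : ℝ) < n := by exact_mod_cast hn
  have : Nonempty {f : H // ‖f‖ ≤ 1} := ⟨⟨0, by simp⟩⟩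
  rw [mul_comm, ← le_div_iff₀ hn0]
  refine ciSup_le fun f => ?_
  obtain ⟨f, hf⟩ := f
  dsimp only
  have hinner : ⟪f, T f⟫_ℂ = ((∑ i, ‖f (xs i)‖ ^ 2 / samplingDensity H ϱ (xs i) -
      n * ∫ x, ‖f x‖ ^ 2 ∂ϱ : ℝ) : ℂ) := by
    rw [hT, sub_apply, inner_sub_right, inner_sum_rankOne_self,
      smul_apply, ContinuousLinearMap.comp_apply, ← norm_sq_embL2 hmeas htr]
    simp_rw [norm_sq_inner_weightedKerFun]
    rw [show (n : ℝ) • (embL2 hmeas htr).adjoint (embL2 hmeas htr f) =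
      (n : ℂ) • (embL2 hmeas htr).adjoint (embL2 hmeas htr f) by
        rw [Nat.cast_smul_eq_nsmul, Nat.cast_smul_eq_nsmul], inner_smul_right,
      ContinuousLinearMap.adjoint_inner_right, inner_self_eq_norm_sq_to_K]
    push_cast
    rfl
  have hle : ‖⟪f, T f⟫_ℂ‖ ≤ ‖T‖ := by
    refine (norm_inner_le_norm _ _).trans ?_
    have h1 : ‖T f‖ ≤ ‖T‖ := (T.le_opNorm f).trans (mul_le_of_le_one_right (norm_nonneg _) hf)
    exact (mul_le_of_le_one_left (norm_nonneg _) hf).trans h1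
  rw [hinner, Complex.norm_real, Real.norm_eq_abs] at hle
  rw [le_div_iff₀ hn0]
  rw [abs_sub_comm] at hle
  refine le_of_eq_of_le ?_ hle
  nth_rw 2 [← abs_of_pos hn0]
  rw [← abs_mul]
  congr 1
  field_simp

theorem measureReal_lt_weightedDiscrError_le [TopologicalSpace.SeparableSpace H]
    (hmeas : ∀ f : H, AEStronglyMeasurable (fun x => f x) ϱ)
    (htr : FiniteTrace H ϱ) (hpos : 0 < kernelTrace H ϱ) {n : ℕ} (hn : 1 ≤ n) {t : ℝ}
    (ht : 0 < t) (ht1 : t ≤ 1) :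
    (Measure.pi fun _ : Fin n => samplingMeasure H ϱ).real
        {xs | t * ‖embL2 hmeas htr‖ ^ 2 < weightedDiscrError H ϱ xs} ≤
      (2 : ℝ) ^ (3 / 4 : ℝ) * n *
        Real.exp (-(n * t ^ 2 * ‖embL2 hmeas htr‖ ^ 2 / (21 * kernelTrace H ϱ))) := by
  have := isProbabilityMeasure_samplingMeasure H ϱ htr hpos
  have hn0 : (0 : ℝ) < n := by exact_mod_cast hn
  set μ := samplingMeasure H ϱ with hμ
  have hv := aestronglyMeasurable_weightedKerFun hmeas htr
  -- a strongly measurable version that satisfies the norm bound everywhere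
  let S : Set X := {x | ‖hv.mk _ x‖ ^ 2 ≤ kernelTrace H ϱ}
  have hS : MeasurableSet S :=
    measurableSet_le (hv.stronglyMeasurable_mk.norm.measurable.pow_const 2) measurable_const
  let v : X → H := S.indicator (hv.mk _)
  have hvm : StronglyMeasurable v := hv.stronglyMeasurable_mk.indicator hS
  have hvM (x) : ‖v x‖ ^ 2 ≤ kernelTrace H ϱ := by
    by_cases hx : x ∈ S
    · simp only [v, Set.indicator_of_mem hx]
      exact hx
    · simp [v, Set.indicator_of_notMem hx, hpos.le]
  have hae : ∀ᵐ x ∂μ, weightedKerFun H ϱ x = v x := by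
    filter_upwards [hv.ae_eq_mk] with x hx
    have hxS : x ∈ S := by
      change ‖hv.mk _ x‖ ^ 2 ≤ _
      rw [← hx]
      exact norm_sq_weightedKerFun_le x
    simp only [v, Set.indicator_of_mem hxS, hx]
  have hΛ : ∫ w, InnerProductSpace.rankOne ℂ (v w) (v w) ∂μ =
      (embL2 hmeas htr).adjoint ∘L embL2 hmeas htr := by
    rw [← integral_rankOne_weightedKerFun hmeas htr hpos]
    refine integral_congr_ae ?_
    filter_upwards [hae] with x hx
    rw [hx]
  have hL : ‖∫ w, InnerProductSpace.rankOne ℂ (v w) (v w) ∂μ‖ ≤ ‖embL2 hmeas htr‖ ^ 2 := by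
    rw [hΛ, ContinuousLinearMap.norm_adjoint_comp_self, sq]
  have hconc := measureReal_lt_norm_sum_rankOne_sub_le hvm hpos hvM hL
    (norm_sq_embL2_le_kernelTrace hmeas htr) hn ht ht1
  rw [hΛ] at hconc
  -- Almost everywhere inclusion suffices; it needs no measurability of the event, whose error is an
  -- uncountable supremum.
  refine le_trans (ENNReal.toReal_mono (measure_ne_top _ _) (measure_mono_ae ?_)) hconc
  have hall : ∀ᵐ xs ∂(Measure.pi fun _ : Fin n => μ), ∀ i, weightedKerFun H ϱ (xs i) = v (xs i) :=
    Filter.eventually_all.2 fun i =>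
      (Measure.quasiMeasurePreserving_eval (fun _ : Fin n => μ) i).ae hae
  filter_upwards [hall] with xs hxs hlt
  have h1 := weightedDiscrError_le hmeas htr hn xs
  simp only [hxs] at h1
  exact (mul_lt_mul_of_pos_left hlt hn0).trans_le h1

end RandomNodes

/-! ### The two probability estimates -/

theorem theorem6p3 {d : ℕ} (D : Set (EuclideanSpace ℝ (Fin d))) (_hD : MeasurableSet D)
    (ϱ : Measure D)
    (H : Type*) [NormedAddCommGroup H] [InnerProductSpace ℂ H] [CompleteSpace H]
    [RKHS ℂ H D ℂ] [TopologicalSpace.SeparableSpace H]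
    (hmeas : ∀ f : H, AEStronglyMeasurable (fun x => f x) ϱ)
    (htr : FiniteTrace H ϱ) (_hpos : 0 < kernelTrace H ϱ)
    (n : ℕ) (_hn : 1 ≤ n) :
    (∀ t : ℝ, 0 < t → t ≤ 1 →
      (Measure.pi fun _ : Fin n => samplingMeasure H ϱ).real
          {xs | t * ‖embL2 hmeas htr‖ ^ 2 < weightedDiscrError H ϱ xs} ≤
        (2 : ℝ) ^ (3 / 4 : ℝ) * n *
          Real.exp (-(n * t ^ 2 * ‖embL2 hmeas htr‖ ^ 2 / (21 * kernelTrace H ϱ)))) ∧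
    (∀ r : ℝ, 1 < r →
      21 * r * kernelTrace H ϱ * Real.log n ≤ n * ‖embL2 hmeas htr‖ ^ 2 →
      1 - 2 * (n : ℝ) ^ (1 - r) <
        (Measure.pi fun _ : Fin n => samplingMeasure H ϱ).real
          {xs | weightedDiscrError H ϱ xs ≤
            Real.sqrt (21 * kernelTrace H ϱ * ‖embL2 hmeas htr‖ ^ 2 * r * (Real.log n / n))}) := by
  refine ⟨fun t ht ht1 => measureReal_lt_weightedDiscrError_le hmeas htr _hpos _hn ht ht1,
    fun r hr hlog => ?_⟩
  have := isProbabilityMeasure_samplingMeasure H ϱ htr _hpos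
  have hn0 : (0 : ℝ) < n := by exact_mod_cast _hn
  rcases _hn.eq_or_lt with rfl | hn2
  -- For n = 1 the lower bound is 1 − 2 < 0.
  · refine lt_of_lt_of_le ?_ measureReal_nonneg
    norm_num
  set P := Measure.pi fun _ : Fin n => samplingMeasure H ϱ with hP
  set L := ‖embL2 hmeas htr‖ ^ 2 with hL
  set M := kernelTrace H ϱ with hM
  have hlog0 : 0 < Real.log n := Real.log_pos (by exact_mod_cast hn2)
  have hr0 : 0 < r := one_pos.trans hr
  have hnL : 0 < n * L := lt_of_lt_of_le (by positivity) hlog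
  have hL0 : 0 < L := (pos_iff_pos_of_mul_pos hnL).1 hn0
  -- Chosen so that the exponential in the tail bound equals n^(−r); the assumption on n says
  -- exactly t ≤ 1.
  set t := Real.sqrt (21 * r * M * Real.log n / (n * L)) with ht
  have ht0 : 0 < t := Real.sqrt_pos.2 (by positivity)
  have ht2 : t ^ 2 = 21 * r * M * Real.log n / (n * L) := Real.sq_sqrt (by positivity)
  have ht1 : t ≤ 1 := Real.sqrt_le_one.2 ((div_le_one hnL).2 hlog)
  have htL : Real.sqrt (21 * M * L * r * (Real.log n / n)) = t * L := by
    rw [Real.sqrt_eq_iff_mul_self_eq_of_pos (by positivity), ← sq, mul_pow, ht2]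
    field_simp
  have htail := measureReal_lt_weightedDiscrError_le hmeas htr _hpos _hn ht0 ht1
  rw [← hL, ← hM, ← hP, ht2] at htail
  have hexp : Real.exp (-(n * (21 * r * M * Real.log n / (n * L)) * L / (21 * M))) =
      (n : ℝ) ^ (-r) := by
    rw [Real.rpow_def_of_pos hn0]
    congr 1
    field_simp
  have hpow : (n : ℝ) * (n : ℝ) ^ (-r) = (n : ℝ) ^ (1 - r) := by
    rw [sub_eq_add_neg, Real.rpow_add hn0, Real.rpow_one]
  rw [hexp, mul_assoc, hpow] at htail
  -- The slack between 2^(3/4) and 2 makes the final inequality strict.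
  have hlt : (2 : ℝ) ^ (3 / 4 : ℝ) < 2 := by
    conv_rhs => rw [← Real.rpow_one 2]
    exact Real.rpow_lt_rpow_of_exponent_lt one_lt_two (by norm_num)
  have hstrict := mul_lt_mul_of_pos_right hlt (Real.rpow_pos_of_pos hn0 (1 - r))
  -- Subadditivity replaces the complement rule, which would need a measurable event.
  have hunion : 1 ≤ P.real {xs | weightedDiscrError H ϱ xs ≤ t * L} +
      P.real {xs | t * L < weightedDiscrError H ϱ xs} := by
    refine le_trans ?_ (measureReal_union_le _ _)
    rw [show {xs | weightedDiscrError H ϱ xs ≤ t * L} ∪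
        {xs : Fin n → D | t * L < weightedDiscrError H ϱ xs} = Set.univ from
      Set.eq_univ_of_forall fun xs => le_or_gt (weightedDiscrError H ϱ xs) (t * L), probReal_univ]
  rw [htL]
  linarith
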